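/- Let $$W(z)=e^{Az+\frac{A_0}{z}}\,z^{B}\, \frac{\prod_{\nu}\left(1+\frac{z}{a_\nu}\right)^{\kappa_\nu}}{\prod_{\mu}\left(1-\frac{z}{b_\mu}\right)^{\lambda_\mu}}\cdot \frac{\prod_{\nu}\left(1+\frac{1}{zc_\nu}\right)^{\widetilde\kappa_\nu}}{\prod_{\mu}\left(1-\frac{1}{zd_\mu}\right)^{\widetilde\lambda_\mu}},$$ where $A,A_0\ge 0$, $B\in\mathbb R$, the (empty, finite or infinite) families $a_\nu,b_\mu,c_\nu,d_\mu$ consist of positive reals, the exponents $\kappa_\nu,\lambda_\mu,\widetilde\kappa_\nu,\widetilde\lambda_\mu$ are positive integers, and the products converge absolutely, i.e. the sums $\sum\kappa_\nu/a_\nu$, $\sum\lambda_\mu/b_\mu$, $\sum\widetilde\kappa_\nu/c_\nu$, $\sum\widetilde\lambda_\mu/d_\mu$ are finite. Here $z^B$ is the principal branch: it is positive for $z>0$, continuous on $\{\operatorname{Im} z\ge 0\}\setminus\{0\}$, and $\overline{z}^{\,B}=\overline{z^B}$ for $\operatorname{Im}z\ne0$; thus on the negative axis $W$ denotes its boundary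 value from above. Assume $W(z)\not\equiv z^B$. Let $\alpha\in\mathbb C$ be such that $\alpha$, $\alpha e^{iB\pi}$ and $\alpha e^{-iB\pi}$ are all non-real. The $\alpha$-set of $W$ is the set of $z\ne0$ with $W(z)=\alpha$, together with $z=0$ if $W(z)\to\alpha$ as $z\to0$; its elements are the $\alpha$-points. Then: 1. every $\alpha$-point $z$ is non-real and simple, i.e. $W$ is holomorphic at $z$ and $W'(z)\ne 0$; 2. distinct $\alpha$-points have distinct absolute values; 3. for all $0<r\le R$ only finitely many $\alpha$-points satisfy $r\le|z|\le R$, so that the $\alpha$-points can be numbered in the order of increasing absolute value; and if $z_i,z_{i+1}$ are consecutive $\alpha$-points in this order, then $\operatorname{Im}z_i\cdot\operatorname{Im}z_{i+1}<0$; 4. for every $x>0$ one has $W(x)\ne\alpha$, and the limits $W_\pm(-x)=\lim_{y\to\pm0}W(-x+iy)$ exist and are different from $\alpha$. -/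

import Mathlib

open Filter Topology

/-- Admissible data `(a, κ)` for the factors `(1 + z / a ν) ^ κ ν`: positive reals with positive
integer exponents, such that the product is absolutely convergent. The index type may be empty,
finite or infinite (summability forces it to be countable). -/
structure IsFactorFamily {ι : Type*} (a : ι → ℝ) (κ : ι → ℕ) : Prop where
  pos : ∀ ν, 0 < a ν
  exponent_pos : ∀ ν, 0 < κ ν
  summable : Summable fun ν => (κ ν : ℝ) / a ν

/-- The function
`e^(A z + A₀ / z) z^B · ∏ (1 + z/a)^κ / ∏ (1 - z/b)^lam · ∏ (1 + 1/(z c))^κ' / ∏ (1 - 1/(z d))^lam'`.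
Here `z ^ (B : ℂ)` is the principal branch: it is positive for `z > 0`, continuous on the closed
upper half-plane without the origin, and satisfies `conj z ↦ conj (z ^ B)` off the negative axis.
On the negative axis it equals its boundary value from above. -/
noncomputable def genW {ι₁ ι₂ ι₃ ι₄ : Type*} (A A₀ B : ℝ)
    (a : ι₁ → ℝ) (κ : ι₁ → ℕ) (b : ι₂ → ℝ) (lam : ι₂ → ℕ)
    (c : ι₃ → ℝ) (κ' : ι₃ → ℕ) (d : ι₄ → ℝ) (lam' : ι₄ → ℕ) (z : ℂ) : ℂ :=
  Complex.exp (A * z + A₀ / z) * z ^ (B : ℂ)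
    * ((∏' ν, (1 + z / (a ν : ℂ)) ^ κ ν) / (∏' μ, (1 - z / (b μ : ℂ)) ^ lam μ))
    * ((∏' ν, (1 + 1 / (z * (c ν : ℂ))) ^ κ' ν) / (∏' μ, (1 - 1 / (z * (d μ : ℂ))) ^ lam' μ))

/-- The set of `α`-points of `f`, for a function `f` given by a formula off the origin: the origin
belongs to it when `f` extends continuously to the origin by the value `α`. -/
def alphaSet (f : ℂ → ℂ) (α : ℂ) : Set ℂ :=
  {z | (z ≠ 0 ∧ f z = α) ∨ (z = 0 ∧ Tendsto f (𝓝[≠] 0) (𝓝 α))}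

/-- `z` and `w` are consecutive points of `S` (in this order) in an ordering of `S` by modulus. -/
def ConsecutiveByNorm (S : Set ℂ) (z w : ℂ) : Prop :=
  z ∈ S ∧ w ∈ S ∧ z ≠ w ∧ ‖z‖ ≤ ‖w‖ ∧ ∀ u ∈ S, ¬ (‖z‖ < ‖u‖ ∧ ‖u‖ < ‖w‖)

/-! Off the real axis `W = exp F`, and `z * F' z` has imaginary part of the same sign as `z.im`.
Indeed a factor `1 + q z` contributes `q z / (1 + q z)`, whose imaginary part is `q * z.im / |1 + q
z| ^ 2`, and negative `q` occur only in the denominator; for the factors in `z⁻¹`, inversion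
exchanges the half-planes but its derivative supplies a second minus sign. The factor `z ^ B`
contributes the real constant `B`, so the sign is strict because `W` is not just `z ^ B`.

In the coordinate `ζ = log z` of the strip `0 < Im ζ < π`, the derivative of `F (exp ζ)` therefore
has positive imaginary part. Consequently `|W|` strictly decreases along every upper half-circle
from the positive to the negative axis, and on a level set of `|W|` the imaginary part of `F`, an
argument of `W`, strictly increases with `|z|` (`im_comp_exp_sub_mul_conj_pos`).

By reflection, `α`-points in the lower half-plane are mirror images of `conj α`-points in the upper
one, and both values have the same modulus. Monotonicity on half-circles gives distinct moduli.
Between two upper points with the same value the argument grows by at least `2π`, hence passes an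
argument of the conjugate value; this gives the alternation. The level curve may be interrupted at
the real axis. `exists_level_point` bridges the gaps along the edges of a slightly smaller strip,
and the boundary behaviour shows that the wanted argument is not attained there: near the positive
axis `W` is almost real or large, and not small, so it avoids the segment from `0` to the value;
near the negative axis `W * exp (-iπB)` is almost real and bounded, so `W` avoids the ray from the
value to infinity. The same behaviour keeps `α`-points from accumulating at nonzero real points. -/

/-! ### Products of real linear factors and their logarithmic derivatives -/

/-- The sum of the logarithms of the factors `(1 + q i * z) ^ k i`. -/
noncomputable def logLinProd {ι : Type*} (q : ι → ℝ) (k : ι → ℕ) (z : ℂ) : ℂ :=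
  ∑' i, (k i : ℂ) * Complex.log (1 + q i * z)

/-- The product of the factors `(1 + q i * z) ^ k i`. -/
noncomputable def linProd {ι : Type*} (q : ι → ℝ) (k : ι → ℕ) (z : ℂ) : ℂ :=
  ∏' i, (1 + q i * z) ^ k i

/-- The sum of the logarithmic derivatives of the factors `(1 + q i * z) ^ k i`. -/
noncomputable def derivLogLinProd {ι : Type*} (q : ι → ℝ) (k : ι → ℕ) (z : ℂ) : ℂ :=
  ∑' i, (k i : ℂ) * (q i / (1 + q i * z))

section LinProd

variable {ι : Type*} {q : ι → ℝ} {k : ι → ℕ}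

lemma one_add_ofReal_mul_ne_zero (q : ℝ) {z : ℂ} (hz : z.im ≠ 0) : 1 + (q : ℂ) * z ≠ 0 := by
  intro h
  have him := congrArg Complex.im h
  have hre := congrArg Complex.re h
  simp [hz] at him hre
  simp [him] at hre

lemma one_add_ofReal_mul_mem_slitPlane (q : ℝ) {z : ℂ} (hz : z.im ≠ 0) :
    1 + (q : ℂ) * z ∈ Complex.slitPlane := by
  rw [Complex.mem_slitPlane_iff]
  by_cases hq : q = 0
  · left; simp [hq]
  · right; simp [hq, hz]

lemma summable_mul_log_one_add (hs : Summable fun i => (k i : ℝ) * |q i|) (z : ℂ) :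
    Summable fun i => (k i : ℂ) * Complex.log (1 + q i * z) := by
  have hs' := hs.mul_right ‖z‖
  apply (hs'.mul_left (3 / 2)).of_norm_bounded_eventually
  filter_upwards [hs'.tendsto_cofinite_zero.eventually_le_const one_half_pos] with i hi
  rcases Nat.eq_zero_or_pos (k i) with h0 | h0
  · simp [h0]
  · have h1 : (1 : ℝ) ≤ k i := by exact_mod_cast h0
    have h2 : ‖(q i : ℂ) * z‖ = |q i| * ‖z‖ := by simp
    have h3 : ‖(q i : ℂ) * z‖ ≤ 1 / 2 := by
      rw [h2]
      refine le_trans ?_ hi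
      rw [mul_assoc]
      exact le_mul_of_one_le_left (by positivity) h1
    have h4 := Complex.norm_log_one_add_half_le_self h3
    rw [norm_mul, Complex.norm_natCast]
    calc (k i : ℝ) * ‖Complex.log (1 + q i * z)‖ ≤ k i * (3 / 2 * ‖(q i : ℂ) * z‖) := by gcongr
      _ = _ := by rw [h2]; ring

lemma exp_logLinProd (hs : Summable fun i => (k i : ℝ) * |q i|) {z : ℂ}
    (hz : ∀ i, 1 + (q i : ℂ) * z ≠ 0) : Complex.exp (logLinProd q k z) = linProd q k z := by
  have h := (summable_mul_log_one_add hs z).hasSum.cexp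
  refine (HasProd.tprod_eq ?_).symm
  unfold logLinProd
  convert h using 2 with i
  simp [Complex.exp_nat_mul, Complex.exp_log (hz i)]

/-- With `y = n * ‖x‖` the left side is at most `exp y - 1 ≤ y * exp y`. The bound is linear in `y`,
so summability with multiplicities suffices for the majorant in `continuous_linProd`. -/
lemma norm_one_add_pow_sub_one_le (x : ℂ) (n : ℕ) {C : ℝ} (hC : n * ‖x‖ ≤ C) :
    ‖(1 + x) ^ n - 1‖ ≤ n * ‖x‖ * Real.exp C := by
  have h := Finset.norm_prod_one_add_sub_one_le (Finset.range n) (fun _ => x)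
  simp only [Finset.prod_const, Finset.card_range, Finset.sum_const, nsmul_eq_mul] at h
  refine h.trans ?_
  set y := (n : ℝ) * ‖x‖
  have hy : 0 ≤ y := by positivity
  have h1 : 1 - y ≤ Real.exp (-y) := by linarith [Real.add_one_le_exp (-y)]
  have h2 : Real.exp y * Real.exp (-y) = 1 := by rw [← Real.exp_add]; simp
  have h3 : Real.exp y ≤ Real.exp C := Real.exp_le_exp.2 hC
  have h4 := Real.exp_pos y
  nlinarith

/-- Locally uniform convergence of the product itself, without logarithms, because continuity is
also needed at its zeros on the real axis. -/
lemma continuous_linProd (hs : Summable fun i => (k i : ℝ) * |q i|) :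
    Continuous (linProd q k) := by
  rw [continuous_iff_continuousAt]
  intro z₀
  set R := ‖z₀‖ + 1
  set C := (∑' i, (k i : ℝ) * |q i|) * R
  have hR : 0 ≤ R := by positivity
  have hu : Summable fun i => (k i : ℝ) * |q i| * R * Real.exp C :=
    (hs.mul_right R).mul_right _
  have H := Summable.hasProdUniformlyOn_one_add (f := fun i z => (1 + (q i : ℂ) * z) ^ k i - 1)
    (isCompact_closedBall (0 : ℂ) R) hu (Eventually.of_forall fun i z hz => by
      have hz' : ‖z‖ ≤ R := by simpa using hz
      have h1 : (k i : ℝ) * ‖(q i : ℂ) * z‖ ≤ k i * |q i| * R := by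
        rw [norm_mul, Complex.norm_real, Real.norm_eq_abs, ← mul_assoc]
        gcongr
      have h2 : (k i : ℝ) * |q i| * R ≤ C := by
        refine mul_le_mul_of_nonneg_right ?_ hR
        exact hs.le_tsum i fun j _ => by positivity
      refine (norm_one_add_pow_sub_one_le _ _ (h1.trans h2)).trans ?_
      gcongr) (fun i => by fun_prop)
  rw [hasProdUniformlyOn_iff_tendstoUniformlyOn] at H
  have hc : ContinuousOn (linProd q k) (Metric.closedBall 0 R) := by
    have := H.continuousOn (Frequently.of_forall fun s => by fun_prop)
    simp only [add_sub_cancel] at this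
    exact this
  refine hc.continuousAt (Metric.closedBall_mem_nhds_of_mem ?_)
  simp [R]

lemma linProd_conj (z : ℂ) :
    linProd q k (starRingEnd ℂ z) = starRingEnd ℂ (linProd q k z) := by
  unfold linProd
  -- Conjugation is a continuous involution, so it commutes with `∏'` whether or not the product
  -- converges.
  rw [Function.LeftInverse.map_tprod (g := starRingEnd ℂ) (g' := starRingEnd ℂ) _
    Complex.continuous_conj Complex.continuous_conj Complex.conj_conj]
  simp

lemma linProd_ne_zero (hs : Summable fun i => (k i : ℝ) * |q i|) {z : ℂ}
    (hz : ∀ i, 1 + (q i : ℂ) * z ≠ 0) : linProd q k z ≠ 0 :=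
  exp_logLinProd hs hz ▸ Complex.exp_ne_zero _

/-- `z * conj (q z)` is real, so `z * conj (1 + q z)` has the imaginary part of `z`. This bounds `|1
+ q z|` below uniformly in `q`. -/
lemma abs_im_le_norm_mul_norm_one_add (q : ℝ) (z : ℂ) :
    |z.im| ≤ ‖z‖ * ‖1 + (q : ℂ) * z‖ := by
  have h : z.im = (z * starRingEnd ℂ (1 + (q : ℂ) * z)).im := by
    simp; ring
  calc |z.im| = |(z * starRingEnd ℂ (1 + (q : ℂ) * z)).im| := by rw [← h]
    _ ≤ ‖z * starRingEnd ℂ (1 + (q : ℂ) * z)‖ := Complex.abs_im_le_norm _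
    _ = _ := by rw [norm_mul, Complex.norm_conj]

lemma hasDerivAt_logLinProd (hs : Summable fun i => (k i : ℝ) * |q i|) {z : ℂ} (hz : z.im ≠ 0) :
    HasDerivAt (logLinProd q k) (derivLogLinProd q k z) z := by
  -- On the ball of this radius `|Im w| ≥ δ`, which gives a uniform majorant for termwise
  -- differentiation.
  set δ := |z.im| / 2
  have hδ : 0 < δ := by positivity
  have him : ∀ w ∈ Metric.ball z δ, δ ≤ |w.im| := by
    intro w hw
    have h1 : |(w - z).im| < δ := (Complex.abs_im_le_norm _).trans_lt (by simpa [dist_eq_norm] using hw)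
    have h2 := abs_sub_abs_le_abs_sub z.im w.im
    rw [Complex.sub_im, abs_sub_comm] at h1
    have : |z.im| = 2 * δ := by simp [δ]; ring
    linarith
  have hne : ∀ w ∈ Metric.ball z δ, w.im ≠ 0 := fun w hw h => by
    have := him w hw
    simp [h] at this
    linarith
  refine hasDerivAt_tsum_of_isPreconnected (g := fun i w => (k i : ℂ) * Complex.log (1 + q i * w))
    (g' := fun i w => (k i : ℂ) * (q i / (1 + q i * w)))
    (hs.mul_right ((‖z‖ + δ) / δ)) Metric.isOpen_ball
    (convex_ball z δ).isPreconnected ?_ ?_ (Metric.mem_ball_self hδ)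
    (summable_mul_log_one_add hs z) (Metric.mem_ball_self hδ)
  · intro i w hw
    have h1 : HasDerivAt (fun w : ℂ => 1 + (q i : ℂ) * w) (q i) w := by
      simpa using ((hasDerivAt_id w).const_mul (q i : ℂ)).const_add 1
    exact (h1.clog (one_add_ofReal_mul_mem_slitPlane _ (hne w hw))).const_mul _
  · intro i w hw
    have h1 := abs_im_le_norm_mul_norm_one_add (q i) w
    have h2 : 0 < ‖1 + (q i : ℂ) * w‖ := norm_pos_iff.2 (one_add_ofReal_mul_ne_zero _ (hne w hw))
    have h3 : ‖w‖ ≤ ‖z‖ + δ := by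
      have : ‖w - z‖ < δ := by simpa [dist_eq_norm] using hw
      linarith [norm_sub_norm_le w z]
    have h4 : δ ≤ (‖z‖ + δ) * ‖1 + (q i : ℂ) * w‖ :=
      (him w hw).trans (h1.trans (by gcongr))
    rw [norm_mul, norm_div, Complex.norm_natCast, Complex.norm_real, Real.norm_eq_abs,
      div_eq_mul_inv, ← mul_assoc]
    refine mul_le_mul_of_nonneg_left ?_ (by positivity)
    rwa [inv_le_iff_one_le_mul₀ h2, div_mul_eq_mul_div, one_le_div hδ]

lemma summable_derivLogLinProd (hs : Summable fun i => (k i : ℝ) * |q i|) {z : ℂ}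
    (hz : z.im ≠ 0) : Summable fun i => (k i : ℂ) * (q i / (1 + q i * z)) := by
  refine (hs.mul_right (‖z‖ / |z.im|)).of_norm_bounded fun i => ?_
  have h2 : 0 < ‖1 + (q i : ℂ) * z‖ := norm_pos_iff.2 (one_add_ofReal_mul_ne_zero _ hz)
  rw [norm_mul, norm_div, Complex.norm_natCast, Complex.norm_real, Real.norm_eq_abs,
    div_eq_mul_inv, ← mul_assoc]
  refine mul_le_mul_of_nonneg_left ?_ (by positivity)
  rw [inv_le_iff_one_le_mul₀ h2, div_mul_eq_mul_div, one_le_div (abs_pos.2 hz)]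
  exact abs_im_le_norm_mul_norm_one_add _ _

lemma hasSum_im_mul_derivLogLinProd (hs : Summable fun i => (k i : ℝ) * |q i|) {z : ℂ}
    (hz : z.im ≠ 0) :
    HasSum (fun i => z.im * (k i * q i / Complex.normSq (1 + q i * z)))
      (z * derivLogLinProd q k z).im := by
  have h := Complex.hasSum_im ((summable_derivLogLinProd hs hz).hasSum.mul_left z)
  unfold derivLogLinProd
  convert h using 2 with i
  have : z * ((k i : ℂ) * (q i / (1 + q i * z)))
      = ((k i * q i / Complex.normSq (1 + q i * z) : ℝ) : ℂ) *
        (z * starRingEnd ℂ (1 + (q i : ℂ) * z)) := by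
    rw [div_eq_mul_inv, Complex.inv_def]
    push_cast
    ring
  rw [this, Complex.im_ofReal_mul]
  simp
  ring

/-- The sign `σ = ±1` treats numerator factors (`q > 0`) and denominator factors (`q < 0`) together.
-/
lemma im_mul_derivLogLinProd_nonneg (hs : Summable fun i => (k i : ℝ) * |q i|) {σ : ℝ}
    (hσ : ∀ i, 0 ≤ σ * q i) {z : ℂ} (hz : z.im ≠ 0) :
    0 ≤ z.im * (σ * (z * derivLogLinProd q k z).im) := by
  refine (((hasSum_im_mul_derivLogLinProd hs hz).mul_left σ).mul_left z.im).nonneg fun i => ?_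
  have := hσ i
  have h : z.im * (σ * (z.im * (k i * q i / Complex.normSq (1 + q i * z))))
      = z.im ^ 2 * (k i * (σ * q i) / Complex.normSq (1 + q i * z)) := by ring
  rw [h]
  have := Complex.normSq_nonneg (1 + q i * z)
  positivity

lemma im_mul_derivLogLinProd_pos (hs : Summable fun i => (k i : ℝ) * |q i|) {σ : ℝ}
    (hσ : ∀ i, 0 < σ * q i) (hk : ∀ i, 0 < k i) [Nonempty ι] {z : ℂ} (hz : z.im ≠ 0) :
    0 < z.im * (σ * (z * derivLogLinProd q k z).im) := by
  have H := ((hasSum_im_mul_derivLogLinProd hs hz).mul_left σ).mul_left z.im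
  have hpos : ∀ i, 0 < z.im * (σ * (z.im * (k i * q i / Complex.normSq (1 + q i * z)))) := by
    intro i
    have h : z.im * (σ * (z.im * (k i * q i / Complex.normSq (1 + q i * z))))
        = z.im ^ 2 * (k i * (σ * q i) / Complex.normSq (1 + q i * z)) := by ring
    rw [h]
    have h1 := Complex.normSq_pos.2 (one_add_ofReal_mul_ne_zero (q i) hz)
    have h2 : (0 : ℝ) < k i := by exact_mod_cast hk i
    have h3 := hσ i
    positivity
  rw [← H.tsum_eq]
  exact H.summable.tsum_pos (fun i => (hpos i).le) (Classical.arbitrary ι) (hpos _)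

end LinProd

/-! ### Monotonicity and level curves in the logarithmic strip -/

section LevelSets

variable {F F' : ℂ → ℂ}

lemma im_exp_pos {ζ : ℂ} (h0 : 0 < ζ.im) (h1 : ζ.im < Real.pi) : 0 < (Complex.exp ζ).im := by
  rw [Complex.exp_im]
  exact mul_pos (Real.exp_pos _) (Real.sin_pos_of_pos_of_lt_pi h0 h1)

/-- If `z * F' z` has positive imaginary part in the upper half-plane, the difference quotients of
`ζ ↦ F (exp ζ)` in the strip `0 < Im ζ < π` have positive imaginary part. -/
lemma im_comp_exp_sub_mul_conj_pos (hF : ∀ z : ℂ, 0 < z.im → HasDerivAt F (F' z) z)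
    (hF' : ∀ z : ℂ, 0 < z.im → 0 < (z * F' z).im) {ζ₁ ζ₂ : ℂ} (hne : ζ₁ ≠ ζ₂)
    (h₁ : ζ₁.im ∈ Set.Ioo 0 Real.pi) (h₂ : ζ₂.im ∈ Set.Ioo 0 Real.pi) :
    0 < ((F (Complex.exp ζ₂)).im - (F (Complex.exp ζ₁)).im) * (ζ₂.re - ζ₁.re)
      - ((F (Complex.exp ζ₂)).re - (F (Complex.exp ζ₁)).re) * (ζ₂.im - ζ₁.im) := by
  set Δ := ζ₂ - ζ₁
  -- The mean value theorem is applied on the segment to `Im (F (exp p) * conj Δ)`; the factor `conj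
  -- Δ` turns the derivative into `|Δ|² * Im (z * F' z)`.
  let p : ℝ → ℂ := fun t => ζ₁ + t * Δ
  have hp : ∀ t ∈ Set.Icc (0 : ℝ) 1, (p t).im ∈ Set.Ioo 0 Real.pi := by
    intro t ht
    have := (convex_Ioo (0 : ℝ) Real.pi) h₁ h₂ (sub_nonneg.2 ht.2) ht.1 (by ring)
    convert this using 1
    simp [p, Δ]
    ring
  have hd : ∀ t ∈ Set.Icc (0 : ℝ) 1, HasDerivAt
      (fun t : ℝ => (F (Complex.exp (p t)) * starRingEnd ℂ Δ).im)
      (Complex.normSq Δ * (Complex.exp (p t) * F' (Complex.exp (p t))).im) t := by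
    intro t ht
    have h1 : HasDerivAt p Δ t := by
      simpa [p] using ((Complex.ofRealCLM.hasDerivAt (x := t)).mul_const Δ).const_add ζ₁
    have h2 := (hF _ (im_exp_pos (hp t ht).1 (hp t ht).2)).comp t h1.cexp
    have h3 := Complex.imCLM.hasFDerivAt.comp_hasDerivAt t (h2.mul_const (starRingEnd ℂ Δ))
    have : F' (Complex.exp (p t)) * (Complex.exp (p t) * Δ) * starRingEnd ℂ Δ
        = (Complex.normSq Δ : ℂ) * (Complex.exp (p t) * F' (Complex.exp (p t))) := by
      rw [← Complex.mul_conj]; ring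
    rw [this, Complex.imCLM_apply, Complex.im_ofReal_mul] at h3
    exact h3
  obtain ⟨t, ht, hs⟩ := exists_hasDerivAt_eq_slope _ _ zero_lt_one
    (fun t ht => (hd t ht).continuousAt.continuousWithinAt)
    (fun t ht => hd t (Set.Ioo_subset_Icc_self ht))
  have ht' := hp t (Set.Ioo_subset_Icc_self ht)
  have hpos : 0 < Complex.normSq Δ * (Complex.exp (p t) * F' (Complex.exp (p t))).im :=
    mul_pos (Complex.normSq_pos.2 (sub_ne_zero.2 hne.symm))
      (hF' _ (im_exp_pos ht'.1 ht'.2))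
  rw [hs] at hpos
  simp [p, Δ] at hpos
  linarith

lemma im_log_mem_Ioo {z : ℂ} (hz : 0 < z.im) : (Complex.log z).im ∈ Set.Ioo 0 Real.pi := by
  rw [Complex.log_im]
  exact ⟨(Complex.arg_nonneg_iff.2 hz.le).lt_of_ne fun h => hz.ne' (Complex.arg_eq_zero_iff.1 h.symm).2,
    Complex.arg_lt_pi_iff.2 (Or.inr hz.ne')⟩

lemma ne_zero_of_im_pos {z : ℂ} (hz : 0 < z.im) : z ≠ 0 := by
  rintro rfl; simp at hz

/-- For distinct points both products in `im_comp_exp_sub_mul_conj_pos` would vanish. -/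
lemma eq_of_norm_eq_of_re_eq (hF : ∀ z : ℂ, 0 < z.im → HasDerivAt F (F' z) z)
    (hF' : ∀ z : ℂ, 0 < z.im → 0 < (z * F' z).im) {z₁ z₂ : ℂ} (h₁ : 0 < z₁.im) (h₂ : 0 < z₂.im)
    (hn : ‖z₁‖ = ‖z₂‖) (hre : (F z₁).re = (F z₂).re) : z₁ = z₂ := by
  by_contra hne
  have hz₁ := ne_zero_of_im_pos h₁
  have hz₂ := ne_zero_of_im_pos h₂
  have h := im_comp_exp_sub_mul_conj_pos hF hF' (ζ₁ := Complex.log z₁) (ζ₂ := Complex.log z₂)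
    (fun h => hne (by rw [← Complex.exp_log hz₁, h, Complex.exp_log hz₂]))
    (im_log_mem_Ioo h₁) (im_log_mem_Ioo h₂)
  rw [Complex.exp_log hz₁, Complex.exp_log hz₂, Complex.log_re, Complex.log_re, hn, hre] at h
  simp at h

/-- Every value `ψ` of the argument strictly between those at two points of a level curve of the
modulus is attained on the level curve, unless it is attained near the ends of the circular arcs
that the level curve does not meet. -/
lemma exists_level_point (hF : ∀ z : ℂ, 0 < z.im → HasDerivAt F (F' z) z)
    (hF' : ∀ z : ℂ, 0 < z.im → 0 < (z * F' z).im) {ζ₁ ζ₂ : ℂ} {c ψ ε : ℝ} (hε : 0 < ε)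
    (hs : ζ₁.re ≤ ζ₂.re)
    (h₁ : ζ₁.im ∈ Set.Icc ε (Real.pi - ε)) (h₂ : ζ₂.im ∈ Set.Icc ε (Real.pi - ε))
    (hc₁ : (F (Complex.exp ζ₁)).re = c) (hc₂ : (F (Complex.exp ζ₂)).re = c)
    (hψ₁ : (F (Complex.exp ζ₁)).im ≤ ψ) (hψ₂ : ψ ≤ (F (Complex.exp ζ₂)).im) :
    ∃ ζ : ℂ, ζ.re ∈ Set.Icc ζ₁.re ζ₂.re ∧ ζ.im ∈ Set.Icc ε (Real.pi - ε) ∧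
      (F (Complex.exp ζ)).im = ψ ∧ ((F (Complex.exp ζ)).re = c ∨
        (ζ.im = ε ∧ (F (Complex.exp ζ)).re ≤ c) ∨
        (ζ.im = Real.pi - ε ∧ c ≤ (F (Complex.exp ζ)).re)) := by
  have hεπ : ε ≤ Real.pi - ε := h₁.1.trans h₁.2
  set K : Set ℂ := Set.Icc ζ₁.re ζ₂.re ×ℂ Set.Icc ε (Real.pi - ε) with hK
  have hKc : IsCompact K := isCompact_Icc.reProdIm isCompact_Icc
  have hstrip : ∀ ζ : ℂ, ζ.im ∈ Set.Icc ε (Real.pi - ε) → ζ.im ∈ Set.Ioo 0 Real.pi :=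
    fun ζ h => ⟨by linarith [h.1], by linarith [h.2]⟩
  have hcont : ContinuousOn (fun ζ => F (Complex.exp ζ)) K := by
    intro ζ hζ
    have hζ' := hstrip ζ (Complex.mem_reProdIm.1 hζ).2
    exact ((hF _ (im_exp_pos hζ'.1 hζ'.2)).continuousAt.comp
      Complex.continuous_exp.continuousAt).continuousWithinAt
  have hcre : ContinuousOn (fun ζ => (F (Complex.exp ζ)).re) K :=
    Complex.continuous_re.comp_continuousOn hcont
  have hcim : ContinuousOn (fun ζ => (F (Complex.exp ζ)).im) K :=
    Complex.continuous_im.comp_continuousOn hcont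
  -- The level curve, continued along the lower edge over arcs where `Re F` stays below `c` and
  -- along the upper edge where it stays above. It is a graph over the real parts: `hle` gives
  -- uniqueness, `hex` existence.
  let Γ : Set ℂ := {ζ ∈ K | (F (Complex.exp ζ)).re = c ∨ (ζ.im = ε ∧ (F (Complex.exp ζ)).re ≤ c) ∨
        (ζ.im = Real.pi - ε ∧ c ≤ (F (Complex.exp ζ)).re)}
  have hΓc : IsCompact Γ := by
    have e : Γ = (K ∩ (fun ζ => (F (Complex.exp ζ)).re) ⁻¹' {c}) ∪
        (((K ∩ (fun ζ => (F (Complex.exp ζ)).re) ⁻¹' Set.Iic c) ∩ Complex.im ⁻¹' {ε}) ∪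
        ((K ∩ (fun ζ => (F (Complex.exp ζ)).re) ⁻¹' Set.Ici c) ∩
          Complex.im ⁻¹' {Real.pi - ε})) := by
      ext ζ; simp [Γ]; tauto
    rw [e]
    have hpre : ∀ s : Set ℝ, IsClosed s →
        IsCompact (K ∩ (fun ζ => (F (Complex.exp ζ)).re) ⁻¹' s) := fun s hs' =>
      hKc.of_isClosed_subset (hcre.preimage_isClosed_of_isClosed hKc.isClosed hs')
        Set.inter_subset_left
    exact (hpre _ isClosed_singleton).union
      (((hpre _ isClosed_Iic).inter_right (isClosed_singleton.preimage Complex.continuous_im)).union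
      ((hpre _ isClosed_Ici).inter_right (isClosed_singleton.preimage Complex.continuous_im)))
  have hanti : ∀ ζ ∈ K, ∀ ζ' ∈ K, ζ.re = ζ'.re → ζ.im < ζ'.im →
      (F (Complex.exp ζ')).re < (F (Complex.exp ζ)).re := by
    intro ζ hζ ζ' hζ' hre him
    have h := im_comp_exp_sub_mul_conj_pos hF hF' (fun e => him.ne (congrArg Complex.im e))
      (hstrip ζ (Complex.mem_reProdIm.1 hζ).2) (hstrip ζ' (Complex.mem_reProdIm.1 hζ').2)
    rw [hre, sub_self, mul_zero] at h
    nlinarith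
  have hle : ∀ ζ ∈ Γ, ∀ ζ' ∈ Γ, ζ.re = ζ'.re → ¬ ζ.im < ζ'.im := by
    intro ζ hζ ζ' hζ' hre him
    have h := hanti ζ hζ.1 ζ' hζ'.1 hre him
    have hb := (Complex.mem_reProdIm.1 hζ.1).2
    have hb' := (Complex.mem_reProdIm.1 hζ'.1).2
    have hb1 := hb.1
    have hb2 := hb'.2
    rcases hζ.2 with a | ⟨a, b⟩ | ⟨a, b⟩ <;> rcases hζ'.2 with a' | ⟨a', b'⟩ | ⟨a', b'⟩ <;> linarith
  have huniq : ∀ ζ ∈ Γ, ∀ ζ' ∈ Γ, ζ.re = ζ'.re → ζ = ζ' := fun ζ hζ ζ' hζ' hre =>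
    Complex.ext hre (le_antisymm (not_lt.1 (hle ζ' hζ' ζ hζ hre.symm))
      (not_lt.1 (hle ζ hζ ζ' hζ' hre)))
  have hex : ∀ s ∈ Set.Icc ζ₁.re ζ₂.re, ∃ ζ ∈ Γ, ζ.re = s := by
    intro s hs'
    have hmem : ∀ θ ∈ Set.Icc ε (Real.pi - ε), (⟨s, θ⟩ : ℂ) ∈ K := fun θ hθ =>
      Complex.mem_reProdIm.2 ⟨hs', hθ⟩
    by_cases ha : (F (Complex.exp ⟨s, ε⟩)).re ≤ c
    · exact ⟨⟨s, ε⟩, ⟨hmem _ ⟨le_rfl, hεπ⟩, Or.inr (Or.inl ⟨rfl, ha⟩)⟩, rfl⟩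
    by_cases hb : c ≤ (F (Complex.exp ⟨s, Real.pi - ε⟩)).re
    · exact ⟨⟨s, Real.pi - ε⟩, ⟨hmem _ ⟨hεπ, le_rfl⟩, Or.inr (Or.inr ⟨rfl, hb⟩)⟩, rfl⟩
    have hl : Continuous fun θ : ℝ => (⟨s, θ⟩ : ℂ) :=
      Complex.equivRealProdCLM.symm.continuous.comp (by fun_prop : Continuous fun θ : ℝ => (s, θ))
    obtain ⟨θ, hθ, hθc⟩ := intermediate_value_Icc' hεπ
      (hcre.comp hl.continuousOn hmem) ⟨(not_le.1 hb).le, (not_le.1 ha).le⟩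
    exact ⟨⟨s, θ⟩, ⟨hmem _ hθ, Or.inl hθc⟩, rfl⟩
  have hΓim : ContinuousOn (fun ζ => (F (Complex.exp ζ)).im) Γ := hcim.mono fun ζ h => h.1
  have hlow : IsCompact (Γ ∩ (fun ζ => (F (Complex.exp ζ)).im) ⁻¹' Set.Iic ψ) :=
    hΓc.of_isClosed_subset (hΓim.preimage_isClosed_of_isClosed hΓc.isClosed isClosed_Iic)
      Set.inter_subset_left
  have hhigh : IsCompact (Γ ∩ (fun ζ => (F (Complex.exp ζ)).im) ⁻¹' Set.Ici ψ) :=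
    hΓc.of_isClosed_subset (hΓim.preimage_isClosed_of_isClosed hΓc.isClosed isClosed_Ici)
      Set.inter_subset_left
  -- The real parts of the points of `Γ` with `Im F ≤ ψ` and with `Im F ≥ ψ` form two closed sets
  -- covering an interval, so they meet. Uniqueness in `Γ` makes the two points above a common real
  -- part coincide.
  have hpre := isPreconnected_closed_iff.1 (isPreconnected_Icc (a := ζ₁.re) (b := ζ₂.re))
    _ _ (hlow.image Complex.continuous_re).isClosed (hhigh.image Complex.continuous_re).isClosed
    (fun s hs' => by
      obtain ⟨ζ, hζ, rfl⟩ := hex s hs'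
      rcases le_total (F (Complex.exp ζ)).im ψ with h | h
      · exact Or.inl ⟨ζ, ⟨hζ, h⟩, rfl⟩
      · exact Or.inr ⟨ζ, ⟨hζ, h⟩, rfl⟩)
    ⟨ζ₁.re, ⟨le_rfl, hs⟩, ζ₁,
      ⟨⟨Complex.mem_reProdIm.2 ⟨⟨le_rfl, hs⟩, h₁⟩, Or.inl hc₁⟩, hψ₁⟩, rfl⟩
    ⟨ζ₂.re, ⟨hs, le_rfl⟩, ζ₂,
      ⟨⟨Complex.mem_reProdIm.2 ⟨⟨hs, le_rfl⟩, h₂⟩, Or.inl hc₂⟩, hψ₂⟩, rfl⟩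
  obtain ⟨s, hs', ⟨ζ, hζ, rfl⟩, ⟨ζ', hζ', hre⟩⟩ := hpre
  obtain rfl := huniq ζ' hζ'.1 ζ hζ.1 hre
  exact ⟨ζ', hs', (Complex.mem_reProdIm.1 hζ.1.1).2, le_antisymm hζ.2 hζ'.2, hζ.1.2⟩

end LevelSets

/-! ### Between two points with the same value -/

section LevelSets

variable {F F' : ℂ → ℂ}

lemma exists_exp_eq_of_arg_between {β γ : ℂ} (hβ : β ≠ 0) (hn : ‖γ‖ = ‖β‖) (hne : γ ≠ β)
    {w₁ w₂ : ℂ} (h₁ : Complex.exp w₁ = β) (h₂ : Complex.exp w₂ = β) (hlt : w₁.im < w₂.im) :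
    ∃ ψ : ℝ, w₁.im < ψ ∧ ψ < w₂.im ∧ Complex.exp ⟨Real.log ‖β‖, ψ⟩ = γ := by
  have hγ : γ ≠ 0 := by rw [← norm_pos_iff, hn, norm_pos_iff]; exact hβ
  have hper : ∀ (a : ℝ) (n : ℤ) (b : ℝ), Complex.exp ⟨a, b + n * (2 * Real.pi)⟩ = Complex.exp ⟨a, b⟩ := by
    intro a n b
    rw [Complex.exp_eq_exp_iff_exists_int]
    exact ⟨n, by apply Complex.ext <;> simp⟩
  obtain ⟨n, hn'⟩ := Complex.exp_eq_exp_iff_exists_int.1 (h₂.trans h₁.symm)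
  have him : w₂.im = w₁.im + n * (2 * Real.pi) := by simpa using congrArg Complex.im hn'
  have hn1 : 1 ≤ n := by
    by_contra hcon
    have : (n : ℝ) ≤ 0 := by exact_mod_cast (by omega : n ≤ 0)
    nlinarith [Real.pi_pos]
  have hn1' : (1 : ℝ) ≤ n := by exact_mod_cast hn1
  -- The argument of `γ` in the period starting at `w₁.im`. It is not `w₁.im` since `γ ≠ β`, and
  -- `w₂.im` lies at least one full period further.
  set ψ := toIcoMod Real.two_pi_pos w₁.im (Complex.arg γ)
  have hmem := toIcoMod_mem_Ico Real.two_pi_pos w₁.im (Complex.arg γ)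
  have hψ : Complex.arg γ = ψ + toIcoDiv Real.two_pi_pos w₁.im (Complex.arg γ) * (2 * Real.pi) := by
    have := toIcoMod_add_toIcoDiv_zsmul Real.two_pi_pos w₁.im (Complex.arg γ)
    rw [zsmul_eq_mul] at this
    exact this.symm
  have hexp : Complex.exp ⟨Real.log ‖β‖, ψ⟩ = γ := by
    rw [← hper _ (toIcoDiv Real.two_pi_pos w₁.im (Complex.arg γ)), ← hψ, ← hn]
    convert Complex.exp_log hγ using 2
    exact Complex.ext (Complex.log_re _).symm (Complex.log_im _).symm
  refine ⟨ψ, hmem.1.lt_of_ne ?_, ?_, hexp⟩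
  · intro he
    apply hne
    rw [← hexp, ← h₁]
    congr 1
    apply Complex.ext
    · simp [Complex.norm_exp]
    · exact he.symm
  · have := hmem.2
    nlinarith [Real.pi_pos]

/-- `hright` and `hleft` serve to rule out the two edge alternatives of `exists_level_point`. -/
lemma exists_mem_upperHalfPlane_between {W : ℂ → ℂ}
    (hF : ∀ z : ℂ, 0 < z.im → HasDerivAt F (F' z) z)
    (hF' : ∀ z : ℂ, 0 < z.im → 0 < (z * F' z).im)
    (hW : ∀ z : ℂ, 0 < z.im → W z = Complex.exp (F z)) {β γ : ℂ} (hn : ‖γ‖ = ‖β‖) (hne : γ ≠ β)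
    (hright : ∀ x : ℝ, 0 < x → ∀ᶠ z in 𝓝[{z : ℂ | 0 < z.im}] (x : ℂ),
      ∀ t ∈ Set.Icc (0 : ℝ) 1, W z ≠ t * γ)
    (hleft : ∀ x : ℝ, 0 < x → ∀ᶠ z in 𝓝[{z : ℂ | 0 < z.im}] (-x : ℂ),
      ∀ t ∈ Set.Icc (0 : ℝ) 1, t * W z ≠ γ)
    {z₁ z₂ : ℂ} (h₁ : 0 < z₁.im) (h₂ : 0 < z₂.im) (hz : z₁ ≠ z₂) (hle : ‖z₁‖ ≤ ‖z₂‖)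
    (hw₁ : W z₁ = β) (hw₂ : W z₂ = β) :
    ∃ u : ℂ, 0 < u.im ∧ W u = γ ∧ ‖z₁‖ < ‖u‖ ∧ ‖u‖ < ‖z₂‖ := by
  have hz₁ := ne_zero_of_im_pos h₁
  have hz₂ := ne_zero_of_im_pos h₂
  set ζ₁ := Complex.log z₁
  set ζ₂ := Complex.log z₂
  have he₁ : Complex.exp ζ₁ = z₁ := Complex.exp_log hz₁
  have he₂ : Complex.exp ζ₂ = z₂ := Complex.exp_log hz₂
  have hi₁ : ζ₁.im ∈ Set.Ioo 0 Real.pi := im_log_mem_Ioo h₁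
  have hi₂ : ζ₂.im ∈ Set.Ioo 0 Real.pi := im_log_mem_Ioo h₂
  have hβ : β ≠ 0 := by rw [← hw₁, hW z₁ h₁]; exact Complex.exp_ne_zero _
  set c := Real.log ‖β‖
  have hre : ∀ z : ℂ, 0 < z.im → ‖W z‖ = ‖β‖ → (F z).re = c := by
    intro z hz hwz
    simp only [c]
    rw [← hwz, hW z hz, Complex.norm_exp, Real.log_exp]
  have hc₁ : (F (Complex.exp ζ₁)).re = c := by rw [he₁]; exact hre _ h₁ (by rw [hw₁])
  have hc₂ : (F (Complex.exp ζ₂)).re = c := by rw [he₂]; exact hre _ h₂ (by rw [hw₂])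
  have hs : ζ₁.re ≤ ζ₂.re := by
    simp only [ζ₁, ζ₂, Complex.log_re]
    exact Real.log_le_log (norm_pos_iff.2 hz₁) hle
  have hmono := im_comp_exp_sub_mul_conj_pos hF hF' (ζ₁ := ζ₁) (ζ₂ := ζ₂)
    (fun h => hz (by rw [← he₁, h, he₂])) hi₁ hi₂
  rw [hc₁, hc₂, sub_self, zero_mul, sub_zero] at hmono
  have hlt : (F (Complex.exp ζ₁)).im < (F (Complex.exp ζ₂)).im := by
    by_contra h
    nlinarith
  obtain ⟨ψ, hψ₁, hψ₂, hψ⟩ := exists_exp_eq_of_arg_between hβ hn hne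
    (by rw [he₁, ← hW z₁ h₁, hw₁] : Complex.exp (F (Complex.exp ζ₁)) = β)
    (by rw [he₂, ← hW z₂ h₂, hw₂] : Complex.exp (F (Complex.exp ζ₂)) = β) hlt
  -- Compactness of the range of `log |z|` turns the local boundary conditions into a single `ε`
  -- valid along both edges.
  have hcpt : IsCompact (Set.Icc ζ₁.re ζ₂.re) := isCompact_Icc
  have hcont : Continuous fun p : ℝ × ℝ => (⟨p.2, p.1⟩ : ℂ) :=
    Complex.equivRealProdCLM.symm.continuous.comp
      (by fun_prop : Continuous fun p : ℝ × ℝ => (p.2, p.1))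
  have E₁ := hcpt.eventually_forall_of_forall_eventually (x₀ := (0 : ℝ))
    (P := fun ε s => 0 < (Complex.exp ⟨s, ε⟩).im →
      ∀ t ∈ Set.Icc (0 : ℝ) 1, W (Complex.exp ⟨s, ε⟩) ≠ t * γ) (by
    intro s _
    have h := eventually_nhdsWithin_iff.1 (hright (Real.exp s) (Real.exp_pos s))
    have hc : Tendsto (fun p : ℝ × ℝ => Complex.exp ⟨p.2, p.1⟩) (𝓝 (0, s))
        (𝓝 (Real.exp s : ℂ)) := by
      have he : Complex.exp ⟨s, 0⟩ = (Real.exp s : ℂ) := by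
        apply Complex.ext <;> simp [Complex.exp_re, Complex.exp_im]
      rw [← he]
      exact (Complex.continuous_exp.comp hcont).tendsto (0, s)
    exact hc.eventually h)
  have E₂ := hcpt.eventually_forall_of_forall_eventually (x₀ := (0 : ℝ))
    (P := fun ε s => 0 < (Complex.exp ⟨s, Real.pi - ε⟩).im →
      ∀ t ∈ Set.Icc (0 : ℝ) 1, t * W (Complex.exp ⟨s, Real.pi - ε⟩) ≠ γ) (by
    intro s _
    have h := eventually_nhdsWithin_iff.1 (hleft (Real.exp s) (Real.exp_pos s))
    have hc : Tendsto (fun p : ℝ × ℝ => Complex.exp ⟨p.2, Real.pi - p.1⟩) (𝓝 (0, s))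
        (𝓝 (-Real.exp s : ℂ)) := by
      have he : Complex.exp ⟨s, Real.pi - 0⟩ = (-Real.exp s : ℂ) := by
        apply Complex.ext <;> simp [Complex.exp_re, Complex.exp_im]
      rw [← he]
      exact ((Complex.continuous_exp.comp hcont).comp
        (by fun_prop : Continuous fun p : ℝ × ℝ => (Real.pi - p.1, p.2))).tendsto (0, s)
    exact hc.eventually h)
  have E₃ : ∀ᶠ ε : ℝ in 𝓝 0, ε < ζ₁.im ∧ ε < ζ₂.im ∧ ε < Real.pi - ζ₁.im ∧ ε < Real.pi - ζ₂.im :=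
    (eventually_lt_nhds hi₁.1).and ((eventually_lt_nhds hi₂.1).and
      ((eventually_lt_nhds (sub_pos.2 hi₁.2)).and (eventually_lt_nhds (sub_pos.2 hi₂.2))))
  obtain ⟨ε, ⟨hE₁, hE₂, hE₃⟩, hε⟩ := (((E₁.and (E₂.and E₃)).filter_mono
    (nhdsWithin_le_nhds (s := Set.Ioi 0))).and self_mem_nhdsWithin).exists
  replace hε : 0 < ε := hε
  obtain ⟨ζ, hζre, hζim, hζψ, hcase⟩ := exists_level_point hF hF' (ψ := ψ) hε hs
    ⟨hE₃.1.le, by linarith⟩ ⟨hE₃.2.1.le, by linarith⟩ hc₁ hc₂ hψ₁.le hψ₂.le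
  have hζ : ζ.im ∈ Set.Ioo 0 Real.pi := ⟨by linarith [hζim.1], by linarith [hζim.2]⟩
  have hpos := im_exp_pos hζ.1 hζ.2
  -- At `ζ` the argument is right, so `W` is a positive multiple of `γ`: the factor is `1` on the
  -- level curve, at most `1` on the lower edge and at least `1` on the upper edge.
  have hWζ : W (Complex.exp ζ) = (Real.exp ((F (Complex.exp ζ)).re - c) : ℝ) * γ := by
    rw [hW _ hpos, ← hψ, Complex.ofReal_exp, ← Complex.exp_add]
    congr 1
    apply Complex.ext <;> simp [hζψ, c]
  rcases hcase with hcase | ⟨him, hcase⟩ | ⟨him, hcase⟩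
  · have hlt₁ : ζ₁.re < ζ.re := by
      have h := im_comp_exp_sub_mul_conj_pos hF hF' (ζ₁ := ζ₁) (ζ₂ := ζ)
        (by rintro rfl; exact hψ₁.ne hζψ) hi₁ hζ
      rw [hc₁, hcase, sub_self, zero_mul, sub_zero, hζψ] at h
      nlinarith
    have hlt₂ : ζ.re < ζ₂.re := by
      have h := im_comp_exp_sub_mul_conj_pos hF hF' (ζ₁ := ζ) (ζ₂ := ζ₂)
        (by rintro rfl; exact hψ₂.ne' hζψ) hζ hi₂
      rw [hc₂, hcase, sub_self, zero_mul, sub_zero, hζψ] at h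
      nlinarith
    refine ⟨Complex.exp ζ, hpos, by simpa [hcase] using hWζ, ?_, ?_⟩
    · rw [← he₁, Complex.norm_exp, Complex.norm_exp]
      exact Real.exp_lt_exp.2 hlt₁
    · rw [← he₂, Complex.norm_exp, Complex.norm_exp]
      exact Real.exp_lt_exp.2 hlt₂
  · have hζe : ζ = ⟨ζ.re, ε⟩ := Complex.ext rfl him
    refine absurd hWζ ?_
    have := hE₁ ζ.re hζre
    rw [← hζe] at this
    exact this hpos _ ⟨(Real.exp_pos _).le, Real.exp_le_one_iff.2 (by linarith)⟩
  · have hζe : ζ = ⟨ζ.re, Real.pi - ε⟩ := Complex.ext rfl him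
    have := hE₂ ζ.re hζre
    rw [← hζe] at this
    refine absurd ?_ (this hpos (Real.exp (c - (F (Complex.exp ζ)).re))
      ⟨(Real.exp_pos _).le, Real.exp_le_one_iff.2 (by linarith)⟩)
    rw [hWζ, ← mul_assoc, ← Complex.ofReal_mul, ← Real.exp_add]
    simp

end LevelSets

/-! ### Boundary behaviour and `α`-points of increasing quotients -/

/-- `W = N / M * z ^ B` with real functions `N`, `M` such that `N` has no zeros on the positive axis
and `M` none on the negative axis, and off the real axis `W = exp F` where `z * F' z` maps the
upper and the lower half-plane into themselves. -/
structure IsIncreasingQuotient (W N M F F' : ℂ → ℂ) (B : ℝ) : Prop where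
  eq_div : ∀ z, W z = N z / M z * z ^ (B : ℂ)
  continuousAt_num : ∀ z, z ≠ 0 → ContinuousAt N z
  continuousAt_den : ∀ z, z ≠ 0 → ContinuousAt M z
  num_conj : ∀ z, N (starRingEnd ℂ z) = starRingEnd ℂ (N z)
  den_conj : ∀ z, M (starRingEnd ℂ z) = starRingEnd ℂ (M z)
  num_ne_zero : ∀ x : ℝ, 0 < x → N x ≠ 0
  den_ne_zero : ∀ x : ℝ, 0 < x → M (-x) ≠ 0
  exp_eq : ∀ z : ℂ, z.im ≠ 0 → Complex.exp (F z) = W z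
  hasDerivAt : ∀ z : ℂ, z.im ≠ 0 → HasDerivAt F (F' z) z
  im_pos : ∀ z : ℂ, z.im ≠ 0 → 0 < z.im * (z * F' z).im

lemma im_eq_zero_of_map_conj {f : ℂ → ℂ} (hf : ∀ z, f (starRingEnd ℂ z) = starRingEnd ℂ (f z))
    (x : ℝ) : (f x).im = 0 := by
  rw [← Complex.conj_eq_iff_im, ← hf, Complex.conj_ofReal]

/-- Rewrites the power through a branch that is continuous across the negative axis. -/
lemma cpow_ofReal_eq_neg_cpow_mul_exp {z : ℂ} (hz : 0 < z.im) (B : ℝ) :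
    z ^ (B : ℂ) = (-z) ^ (B : ℂ) * Complex.exp (Complex.I * B * Real.pi) := by
  have h0 := ne_zero_of_im_pos hz
  rw [Complex.cpow_def_of_ne_zero h0, Complex.cpow_def_of_ne_zero (neg_ne_zero.2 h0),
    ← Complex.exp_add]
  congr 1
  have : Complex.log z = Complex.log (-z) + Real.pi * Complex.I := by
    apply Complex.ext
    · simp [Complex.log_re]
    · simp [Complex.log_im, Complex.arg_neg_eq_arg_sub_pi_of_im_pos hz]
  rw [this]
  ring

lemma neg_ofReal_cpow {x : ℝ} (hx : 0 < x) (B : ℝ) :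
    (-x : ℂ) ^ (B : ℂ) = (x : ℂ) ^ (B : ℂ) * Complex.exp (Complex.I * B * Real.pi) := by
  have := Complex.ofReal_cpow_of_nonpos (neg_nonpos.2 hx.le) (B : ℂ)
  push_cast at this
  rw [this, neg_neg]
  congr 2
  ring

namespace IsIncreasingQuotient

variable {W N M F F' : ℂ → ℂ} {B : ℝ}

lemma den_ne_zero_of_im_ne_zero (h : IsIncreasingQuotient W N M F F' B) {z : ℂ} (hz : z.im ≠ 0) :
    M z ≠ 0 := by
  intro h0
  have h1 := h.exp_eq z hz
  rw [h.eq_div, h0] at h1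
  simp at h1

lemma map_conj (h : IsIncreasingQuotient W N M F F' B) {z : ℂ} (hz : z.im ≠ 0) :
    W (starRingEnd ℂ z) = starRingEnd ℂ (W z) := by
  have harg : z.arg ≠ Real.pi := fun e => hz (Complex.arg_eq_pi_iff.1 e).2
  have hc : starRingEnd ℂ z ^ (B : ℂ) = starRingEnd ℂ (z ^ (B : ℂ)) := by
    have := Complex.cpow_conj z (B : ℂ) harg
    rw [Complex.conj_ofReal] at this
    rw [this, Complex.conj_conj]
  rw [h.eq_div, h.eq_div, h.num_conj, h.den_conj, hc, map_mul, map_div₀]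

/-- Cleared of denominators, the condition makes sense at poles. At `x` the imaginary part of an
equality gives `t = 0` or `M x = 0`, and then `N x = 0`, which is excluded. Compactness of `[0, 1]`
makes the neighbourhood uniform in `t`. -/
lemma eventually_ne_right (h : IsIncreasingQuotient W N M F F' B) {β : ℂ} (hβ : β.im ≠ 0)
    {x : ℝ} (hx : 0 < x) :
    ∀ᶠ z in 𝓝[{z : ℂ | 0 < z.im}] (x : ℂ), ∀ t ∈ Set.Icc (0 : ℝ) 1, W z ≠ t * β := by
  have hx0 : (x : ℂ) ≠ 0 := by exact_mod_cast hx.ne'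
  have E := (isCompact_Icc (a := (0 : ℝ)) (b := 1)).eventually_forall_of_forall_eventually
    (x₀ := (x : ℂ)) (P := fun z t => N z * z ^ (B : ℂ) - t * β * M z ≠ 0) (by
    intro t _
    have hc : ContinuousAt (fun p : ℂ × ℝ => N p.1 * p.1 ^ (B : ℂ) - p.2 * β * M p.1) (x, t) := by
      have h1 : ContinuousAt (fun p : ℂ × ℝ => N p.1) ((x : ℂ), t) :=
        ContinuousAt.comp (f := Prod.fst) (h.continuousAt_num x hx0) continuousAt_fst
      have h2 : ContinuousAt (fun p : ℂ × ℝ => M p.1) ((x : ℂ), t) :=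
        ContinuousAt.comp (f := Prod.fst) (h.continuousAt_den x hx0) continuousAt_fst
      have h3 : ContinuousAt (fun p : ℂ × ℝ => p.1 ^ (B : ℂ)) ((x : ℂ), t) :=
        continuousAt_fst.cpow continuousAt_const (Or.inl (by simpa using hx))
      have h4 : ContinuousAt (fun p : ℂ × ℝ => (p.2 : ℂ)) ((x : ℂ), t) := by fun_prop
      exact (h1.mul h3).sub ((h4.mul continuousAt_const).mul h2)
    refine hc.eventually_ne ?_
    intro h0
    have hN := im_eq_zero_of_map_conj h.num_conj x
    have hM := im_eq_zero_of_map_conj h.den_conj x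
    have hB : (x : ℂ) ^ (B : ℂ) = ((x ^ B : ℝ) : ℂ) := (Complex.ofReal_cpow hx.le B).symm
    have hpos : 0 < x ^ B := Real.rpow_pos_of_pos hx B
    simp only [hB] at h0
    have him := congrArg Complex.im h0
    have hre := congrArg Complex.re h0
    simp [hN, hM, hβ] at him hre
    have : (N x).re = 0 := by
      rcases him with a | a <;> simp [a, hpos.ne'] at hre <;> exact hre
    exact h.num_ne_zero x hx (Complex.ext this hN))
  filter_upwards [nhdsWithin_le_nhds E, self_mem_nhdsWithin] with z hz him t ht hW
  have hM := h.den_ne_zero_of_im_ne_zero (ne_of_gt him)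
  apply hz t ht
  rw [← hW, h.eq_div]
  field_simp
  ring

/-- Dual to `eventually_ne_right`: after removing the phase `exp (iπB)`, an equality at `-x` would
force `M (-x) = 0`. -/
lemma eventually_ne_left (h : IsIncreasingQuotient W N M F F' B) {β : ℂ}
    (hβ : (β * Complex.exp (-(Complex.I * B * Real.pi))).im ≠ 0) {x : ℝ} (hx : 0 < x) :
    ∀ᶠ z in 𝓝[{z : ℂ | 0 < z.im}] (-x : ℂ), ∀ t ∈ Set.Icc (0 : ℝ) 1, t * W z ≠ β := by
  set γ := β * Complex.exp (-(Complex.I * B * Real.pi)) with hγ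
  have hx0 : (-x : ℂ) ≠ 0 := by
    rw [neg_ne_zero]; exact_mod_cast hx.ne'
  have E := (isCompact_Icc (a := (0 : ℝ)) (b := 1)).eventually_forall_of_forall_eventually
    (x₀ := (-x : ℂ)) (P := fun z t => t * (N z * (-z) ^ (B : ℂ)) - γ * M z ≠ 0) (by
    intro t _
    have hc : ContinuousAt (fun p : ℂ × ℝ => p.2 * (N p.1 * (-p.1) ^ (B : ℂ)) - γ * M p.1)
        (-x, t) := by
      have h1 : ContinuousAt (fun p : ℂ × ℝ => N p.1) ((-x : ℂ), t) :=
        ContinuousAt.comp (f := Prod.fst) (h.continuousAt_num _ hx0) continuousAt_fst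
      have h2 : ContinuousAt (fun p : ℂ × ℝ => M p.1) ((-x : ℂ), t) :=
        ContinuousAt.comp (f := Prod.fst) (h.continuousAt_den _ hx0) continuousAt_fst
      have h3 : ContinuousAt (fun p : ℂ × ℝ => (-p.1) ^ (B : ℂ)) ((-x : ℂ), t) :=
        continuousAt_fst.neg.cpow continuousAt_const (Or.inl (by simpa using hx))
      have h4 : ContinuousAt (fun p : ℂ × ℝ => (p.2 : ℂ)) ((-x : ℂ), t) := by fun_prop
      exact (h4.mul (h1.mul h3)).sub (continuousAt_const.mul h2)
    refine hc.eventually_ne ?_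
    intro h0
    have hN := im_eq_zero_of_map_conj h.num_conj (-x)
    have hM := im_eq_zero_of_map_conj h.den_conj (-x)
    have hB : (x : ℂ) ^ (B : ℂ) = ((x ^ B : ℝ) : ℂ) := (Complex.ofReal_cpow hx.le B).symm
    push_cast at hN hM
    simp only [neg_neg, hB] at h0
    have him := congrArg Complex.im h0
    simp [hN, hM, hβ] at him
    exact h.den_ne_zero x hx (Complex.ext him hM))
  filter_upwards [nhdsWithin_le_nhds E, self_mem_nhdsWithin] with z hz him t ht hW
  have hM := h.den_ne_zero_of_im_ne_zero (ne_of_gt him)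
  apply hz t ht
  have he : Complex.exp (Complex.I * B * Real.pi) * Complex.exp (-(Complex.I * B * Real.pi)) = 1 := by
    rw [← Complex.exp_add]; simp
  rw [hγ, ← hW, h.eq_div, cpow_ofReal_eq_neg_cpow_mul_exp him]
  have : (t : ℂ) * (N z / M z * ((-z) ^ (B : ℂ) * Complex.exp (Complex.I * B * Real.pi)))
      * Complex.exp (-(Complex.I * B * Real.pi)) * M z
      = t * (N z / M z * M z) * (-z) ^ (B : ℂ) *
        (Complex.exp (Complex.I * B * Real.pi) * Complex.exp (-(Complex.I * B * Real.pi))) := by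
    ring
  rw [this, he, div_mul_cancel₀ _ hM]
  ring

lemma im_ofReal (h : IsIncreasingQuotient W N M F F' B) {x : ℝ} (hx : 0 < x) :
    (W x).im = 0 := by
  have hN := im_eq_zero_of_map_conj h.num_conj x
  have hM := im_eq_zero_of_map_conj h.den_conj x
  have hB : (x : ℂ) ^ (B : ℂ) = ((x ^ B : ℝ) : ℂ) := (Complex.ofReal_cpow hx.le B).symm
  rw [h.eq_div, hB]
  simp [Complex.div_im, hN, hM]

lemma im_neg_ofReal_mul_exp (h : IsIncreasingQuotient W N M F F' B) {x : ℝ} (hx : 0 < x) :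
    (W (-x) * Complex.exp (-(Complex.I * B * Real.pi))).im = 0 := by
  have hN := im_eq_zero_of_map_conj h.num_conj (-x)
  have hM := im_eq_zero_of_map_conj h.den_conj (-x)
  push_cast at hN hM
  have hB : (x : ℂ) ^ (B : ℂ) = ((x ^ B : ℝ) : ℂ) := (Complex.ofReal_cpow hx.le B).symm
  rw [h.eq_div, neg_ofReal_cpow hx, mul_assoc, mul_assoc, ← Complex.exp_add, add_neg_cancel,
    Complex.exp_zero, mul_one, hB]
  simp [Complex.div_im, hN, hM]

lemma tendsto_neg_ofReal_add_mul_I (h : IsIncreasingQuotient W N M F F' B) {x : ℝ} (hx : 0 < x) :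
    Tendsto (fun y : ℝ => W (-(x : ℂ) + y * Complex.I)) (𝓝[>] 0) (𝓝 (W (-x))) := by
  have hx0 : (-x : ℂ) ≠ 0 := by
    rw [neg_ne_zero]; exact_mod_cast hx.ne'
  have hc : ContinuousAt (fun z => N z / M z *
      ((-z) ^ (B : ℂ) * Complex.exp (Complex.I * B * Real.pi))) (-x : ℂ) := by
    refine ((h.continuousAt_num _ hx0).div (h.continuousAt_den _ hx0) (h.den_ne_zero x hx)).mul
      (ContinuousAt.mul ?_ continuousAt_const)
    exact continuousAt_neg.cpow continuousAt_const (Or.inl (by simpa using hx))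
  have hl : Tendsto (fun y : ℝ => -(x : ℂ) + y * Complex.I) (𝓝[>] 0) (𝓝 (-x : ℂ)) := by
    have : Continuous fun y : ℝ => -(x : ℂ) + y * Complex.I := by fun_prop
    have := this.tendsto 0
    simp only [Complex.ofReal_zero, zero_mul, add_zero] at this
    exact this.mono_left nhdsWithin_le_nhds
  have := hc.tendsto.comp hl
  rw [neg_neg, ← neg_ofReal_cpow hx, ← h.eq_div] at this
  refine this.congr' ?_
  filter_upwards [self_mem_nhdsWithin] with y hy
  rw [h.eq_div, cpow_ofReal_eq_neg_cpow_mul_exp (by simpa using hy), Function.comp_apply]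

lemma tendsto_neg_ofReal_add_mul_I_lt (h : IsIncreasingQuotient W N M F F' B) {x : ℝ}
    (hx : 0 < x) :
    Tendsto (fun y : ℝ => W (-(x : ℂ) + y * Complex.I)) (𝓝[<] 0)
      (𝓝 (starRingEnd ℂ (W (-x)))) := by
  have hneg : Tendsto (fun y : ℝ => -y) (𝓝[<] 0) (𝓝[>] 0) := by
    simpa using tendsto_neg_nhdsLT (a := (0 : ℝ))
  have := (Complex.continuous_conj.tendsto _).comp
    ((h.tendsto_neg_ofReal_add_mul_I hx).comp hneg)
  refine this.congr' ?_
  filter_upwards [self_mem_nhdsWithin] with y hy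
  have hy' : y ≠ 0 := ne_of_lt hy
  simp only [Function.comp_apply]
  rw [← h.map_conj (by simpa using hy')]
  congr 1
  simp

lemma ne_of_im_eq_zero (h : IsIncreasingQuotient W N M F F' B) {α : ℂ} (hα : α.im ≠ 0)
    (hα' : (α * Complex.exp (-(Complex.I * B * Real.pi))).im ≠ 0) {z : ℂ} (hz : z ≠ 0)
    (him : z.im = 0) : W z ≠ α := by
  have hzr : z = (z.re : ℂ) := Complex.ext rfl (by simpa using him)
  rcases lt_trichotomy z.re 0 with h0 | h0 | h0
  · rintro rfl
    apply hα'
    have := h.im_neg_ofReal_mul_exp (neg_pos.2 h0)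
    rw [Complex.ofReal_neg, neg_neg, ← hzr] at this
    exact this
  · exact absurd (Complex.ext h0 him) hz
  · rintro rfl
    apply hα
    rw [hzr]
    exact h.im_ofReal h0

/-- The origin drops out because `W` is real on the positive axis, so a limit at `0` would be real.
-/
lemma mem_alphaSet_iff (h : IsIncreasingQuotient W N M F F' B) {α : ℂ} (hα : α.im ≠ 0)
    (hα' : (α * Complex.exp (-(Complex.I * B * Real.pi))).im ≠ 0) {z : ℂ} :
    z ∈ alphaSet W α ↔ z.im ≠ 0 ∧ W z = α := by
  constructor
  · rintro (⟨hz, hW⟩ | ⟨rfl, hT⟩)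
    · exact ⟨fun him => h.ne_of_im_eq_zero hα hα' hz him hW, hW⟩
    · exfalso
      have hl : Tendsto (fun x : ℝ => (x : ℂ)) (𝓝[>] 0) (𝓝[≠] 0) := by
        refine tendsto_nhdsWithin_of_tendsto_nhds_of_eventually_within _ ?_ ?_
        · have := Complex.continuous_ofReal.tendsto 0
          rw [Complex.ofReal_zero] at this
          exact this.mono_left nhdsWithin_le_nhds
        · filter_upwards [self_mem_nhdsWithin] with x hx
          exact Complex.ofReal_ne_zero.2 (ne_of_gt hx)
      have hi := (Complex.continuous_im.tendsto _).comp (hT.comp hl)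
      refine hα (tendsto_nhds_unique (hi.congr' ?_) tendsto_const_nhds)
      filter_upwards [self_mem_nhdsWithin] with x hx
      exact h.im_ofReal hx
  · rintro ⟨hz, hW⟩
    exact Or.inl ⟨fun e => hz (by simp [e]), hW⟩

lemma hasDerivAt_mul (h : IsIncreasingQuotient W N M F F' B) {z : ℂ} (hz : z.im ≠ 0) :
    HasDerivAt W (W z * F' z) z := by
  have hopen : IsOpen {z : ℂ | z.im ≠ 0} := isOpen_ne_fun Complex.continuous_im continuous_const
  have := (h.hasDerivAt z hz).cexp
  rw [h.exp_eq z hz] at this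
  refine this.congr_of_eventuallyEq ?_
  filter_upwards [hopen.mem_nhds hz] with w hw using (h.exp_eq w hw).symm

lemma mul_deriv_ne_zero (h : IsIncreasingQuotient W N M F F' B) {z : ℂ} (hz : z.im ≠ 0) :
    W z * F' z ≠ 0 := by
  refine mul_ne_zero (h.exp_eq z hz ▸ Complex.exp_ne_zero _) fun h0 => ?_
  have := h.im_pos z hz
  simp [h0] at this

lemma analyticAt (h : IsIncreasingQuotient W N M F F' B) {z : ℂ} (hz : z.im ≠ 0) :
    AnalyticAt ℂ W z := by
  have hopen : IsOpen {z : ℂ | z.im ≠ 0} := isOpen_ne_fun Complex.continuous_im continuous_const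
  have : DifferentiableOn ℂ W {z : ℂ | z.im ≠ 0} := fun w hw =>
    (h.hasDerivAt_mul hw).differentiableAt.differentiableWithinAt
  exact this.analyticAt (hopen.mem_nhds hz)

lemma hasDerivAt_of_im_pos (h : IsIncreasingQuotient W N M F F' B) (z : ℂ) (hz : 0 < z.im) :
    HasDerivAt F (F' z) z := h.hasDerivAt z hz.ne'

lemma im_mul_deriv_pos (h : IsIncreasingQuotient W N M F F' B) (z : ℂ) (hz : 0 < z.im) :
    0 < (z * F' z).im := (mul_pos_iff_of_pos_left hz).1 (h.im_pos z hz.ne')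

lemma eq_of_norm_eq (h : IsIncreasingQuotient W N M F F' B) {z w : ℂ} (hz : 0 < z.im)
    (hw : 0 < w.im) (hn : ‖z‖ = ‖w‖) (hW : ‖W z‖ = ‖W w‖) : z = w := by
  refine eq_of_norm_eq_of_re_eq h.hasDerivAt_of_im_pos h.im_mul_deriv_pos hz hw hn ?_
  rw [← h.exp_eq z hz.ne', ← h.exp_eq w hw.ne', Complex.norm_exp, Complex.norm_exp] at hW
  exact Real.exp_injective hW

lemma eq_of_mem_of_norm_eq (h : IsIncreasingQuotient W N M F F' B) {α : ℂ} (hα : α.im ≠ 0)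
    {z w : ℂ} (hz : z.im ≠ 0) (hw : w.im ≠ 0) (hWz : W z = α) (hWw : W w = α)
    (hn : ‖z‖ = ‖w‖) : z = w := by
  have hcz := h.map_conj hz
  have hcw := h.map_conj hw
  have hαc : α ≠ starRingEnd ℂ α := fun e => hα (Complex.conj_eq_iff_im.1 e.symm)
  rcases lt_or_gt_of_ne hz with hz' | hz' <;> rcases lt_or_gt_of_ne hw with hw' | hw'
  · refine (starRingEnd ℂ).injective (h.eq_of_norm_eq (by simpa using hz') (by simpa using hw') ?_ ?_)
    · simpa using hn
    · rw [hcz, hcw, hWz, hWw]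
  · have := h.eq_of_norm_eq (z := starRingEnd ℂ z) (w := w) (by simpa using hz') hw'
      (by simpa using hn) (by rw [hcz, hWz, hWw, Complex.norm_conj])
    rw [this, hWw, hWz] at hcz
    exact absurd hcz hαc
  · have := h.eq_of_norm_eq (z := z) (w := starRingEnd ℂ w) hz' (by simpa using hw')
      (by simpa using hn) (by rw [hcw, hWz, hWw, Complex.norm_conj])
    rw [← this, hWw, hWz] at hcw
    exact absurd hcw hαc
  · exact h.eq_of_norm_eq hz' hw' hn (by rw [hWz, hWw])

/-- Near a real point other than the origin the upper half-plane contains no solutions of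
`W z = β`. -/
lemma eventually_ne_of_im_eq_zero (h : IsIncreasingQuotient W N M F F' B) {β : ℂ} (hβ : β.im ≠ 0)
    (hβ' : (β * Complex.exp (-(Complex.I * B * Real.pi))).im ≠ 0) {z : ℂ} (hz : z ≠ 0)
    (him : z.im = 0) : ∀ᶠ w in 𝓝 z, 0 < w.im → W w ≠ β := by
  have hzr : z = (z.re : ℂ) := Complex.ext rfl (by simpa using him)
  rcases lt_trichotomy z.re 0 with h0 | h0 | h0
  · have := h.eventually_ne_left hβ' (neg_pos.2 h0)
    rw [Complex.ofReal_neg, neg_neg, ← hzr, eventually_nhdsWithin_iff] at this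
    filter_upwards [this] with w hw hw'
    simpa using hw hw' 1 (by simp)
  · exact absurd (Complex.ext h0 him) hz
  · have := h.eventually_ne_right hβ h0
    rw [← hzr, eventually_nhdsWithin_iff] at this
    filter_upwards [this] with w hw hw'
    simpa using hw hw' 1 (by simp)

/-- The boundary condition for `conj α` at the negative axis is the hypothesis on `α * exp (iπB)`.
-/
lemma im_conj_mul_exp_neg (α : ℂ) (B : ℝ) :
    (starRingEnd ℂ α * Complex.exp (-(Complex.I * B * Real.pi))).im
      = -(α * Complex.exp (Complex.I * B * Real.pi)).im := by
  rw [← Complex.conj_im, map_mul, ← Complex.exp_conj]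
  simp

/-- An accumulation point in the closed annulus cannot be real, by the boundary behaviour for `α`
and `conj α`, nor non-real, since `W' ≠ 0` there. -/
lemma finite_setOf_norm_mem (h : IsIncreasingQuotient W N M F F' B) {α : ℂ} (hα : α.im ≠ 0)
    (hα_pos : (α * Complex.exp (Complex.I * B * Real.pi)).im ≠ 0)
    (hα_neg : (α * Complex.exp (-(Complex.I * B * Real.pi))).im ≠ 0) {r R : ℝ} (hr : 0 < r) :
    {z ∈ alphaSet W α | r ≤ ‖z‖ ∧ ‖z‖ ≤ R}.Finite := by
  by_contra hinf
  have hK : IsCompact ({z : ℂ | r ≤ ‖z‖} ∩ Metric.closedBall 0 R) :=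
    (isCompact_closedBall 0 R).inter_left (isClosed_le continuous_const continuous_norm)
  obtain ⟨z, hzK, hacc⟩ := Set.Infinite.exists_accPt_of_subset_isCompact hinf hK
    (fun z hz => ⟨hz.2.1, by simpa using hz.2.2⟩)
  have hz0 : z ≠ 0 := by
    rintro rfl
    have : r ≤ ‖(0 : ℂ)‖ := hzK.1
    simp at this
    linarith
  rw [accPt_iff_frequently] at hacc
  refine hacc ?_
  have key : ∀ᶠ w in 𝓝 z, w ≠ z → w.im ≠ 0 → W w ≠ α := by
    by_cases him : z.im = 0
    · have hc : Tendsto (starRingEnd ℂ) (𝓝 z) (𝓝 z) := by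
        have := Complex.continuous_conj.tendsto z
        rwa [Complex.conj_eq_iff_im.2 him] at this
      have E₁ := h.eventually_ne_of_im_eq_zero hα hα_neg hz0 him
      have E₂ := hc.eventually (h.eventually_ne_of_im_eq_zero (β := starRingEnd ℂ α)
        (by simpa using hα) (by rw [im_conj_mul_exp_neg]; exact neg_ne_zero.2 hα_pos) hz0 him)
      filter_upwards [E₁, E₂] with w hw₁ hw₂ _ hw
      rcases lt_or_gt_of_ne hw with hw' | hw'
      · intro hW
        exact hw₂ (by simpa using hw') (by rw [h.map_conj hw, hW])
      · exact hw₁ hw'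
    · have := (h.hasDerivAt_mul him).eventually_ne (c := α) (h.mul_deriv_ne_zero him)
      rw [eventually_nhdsWithin_iff] at this
      filter_upwards [this] with w hw hw' _ using hw hw'
  filter_upwards [key] with w hw ⟨hne, hmem, _⟩
  have := (h.mem_alphaSet_iff hα hα_neg).1 hmem
  exact hw hne this.1 this.2

lemma im_mul_im_neg_of_consecutive (h : IsIncreasingQuotient W N M F F' B) {α : ℂ}
    (hα : α.im ≠ 0) (hα_pos : (α * Complex.exp (Complex.I * B * Real.pi)).im ≠ 0)
    (hα_neg : (α * Complex.exp (-(Complex.I * B * Real.pi))).im ≠ 0) {z w : ℂ}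
    (hzw : ConsecutiveByNorm (alphaSet W α) z w) : z.im * w.im < 0 := by
  obtain ⟨hz, hw, hne, hle, hno⟩ := hzw
  have hiff := fun u : ℂ => h.mem_alphaSet_iff hα hα_neg (z := u)
  rw [hiff] at hz hw
  have hαc : starRingEnd ℂ α ≠ α := fun e => hα (Complex.conj_eq_iff_im.1 e)
  have hWF : ∀ z : ℂ, 0 < z.im → W z = Complex.exp (F z) := fun z hz => (h.exp_eq z hz.ne').symm
  have hconj : (starRingEnd ℂ α).im ≠ 0 := by simpa using hα
  have hconj' : (starRingEnd ℂ α * Complex.exp (-(Complex.I * B * Real.pi))).im ≠ 0 := by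
    rw [im_conj_mul_exp_neg]; exact neg_ne_zero.2 hα_pos
  rcases lt_or_gt_of_ne hz.1 with hz' | hz' <;> rcases lt_or_gt_of_ne hw.1 with hw' | hw'
  · exfalso
    obtain ⟨u, hu, hWu, h₁, h₂⟩ := exists_mem_upperHalfPlane_between h.hasDerivAt_of_im_pos
      h.im_mul_deriv_pos hWF (β := starRingEnd ℂ α) (γ := α) (Complex.norm_conj α).symm hαc.symm
      (fun x hx => h.eventually_ne_right hα hx) (fun x hx => h.eventually_ne_left hα_neg hx)
      (z₁ := starRingEnd ℂ z) (z₂ := starRingEnd ℂ w) (by simpa using hz') (by simpa using hw')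
      (fun e => hne ((starRingEnd ℂ).injective e)) (by simpa using hle)
      (by rw [h.map_conj hz.1, hz.2]) (by rw [h.map_conj hw.1, hw.2])
    exact hno u ((hiff u).2 ⟨hu.ne', hWu⟩) ⟨by simpa using h₁, by simpa using h₂⟩
  · exact mul_neg_of_neg_of_pos hz' hw'
  · exact mul_neg_of_pos_of_neg hz' hw'
  · exfalso
    obtain ⟨u, hu, hWu, h₁, h₂⟩ := exists_mem_upperHalfPlane_between h.hasDerivAt_of_im_pos
      h.im_mul_deriv_pos hWF (β := α) (γ := starRingEnd ℂ α) (Complex.norm_conj α) hαc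
      (fun x hx => h.eventually_ne_right hconj hx) (fun x hx => h.eventually_ne_left hconj' hx)
      hz' hw' hne hle hz.2 hw.2
    refine hno (starRingEnd ℂ u) ((hiff _).2 ⟨by simpa using hu.ne', ?_⟩)
      ⟨by simpa using h₁, by simpa using h₂⟩
    rw [h.map_conj hu.ne', hWu, Complex.conj_conj]

end IsIncreasingQuotient

/-! ### The function `W` as an increasing quotient -/

lemma IsFactorFamily.summable_mul_abs_inv {ι : Type*} {a : ι → ℝ} {κ : ι → ℕ}
    (h : IsFactorFamily a κ) : Summable fun i => (κ i : ℝ) * |(a i)⁻¹| := by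
  refine h.summable.congr fun i => ?_
  rw [abs_of_pos (inv_pos.2 (h.pos i)), div_eq_mul_inv]

lemma IsFactorFamily.summable_mul_abs_neg_inv {ι : Type*} {a : ι → ℝ} {κ : ι → ℕ}
    (h : IsFactorFamily a κ) : Summable fun i => (κ i : ℝ) * |-(a i)⁻¹| := by
  simpa only [abs_neg] using h.summable_mul_abs_inv

lemma one_add_inv_mul_ne_zero {a x : ℝ} (ha : 0 < a) (hx : 0 < x) :
    1 + ((a⁻¹ : ℝ) : ℂ) * x ≠ 0 := by
  have : (0 : ℝ) < 1 + a⁻¹ * x := by positivity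
  exact_mod_cast this.ne'

namespace IsFactorFamily

variable {ι : Type*} {a : ι → ℝ} {κ : ι → ℕ} {z : ℂ}

lemma im_mul_inv_nonneg (h : IsFactorFamily a κ) (hz : z.im ≠ 0) :
    0 ≤ z.im * (z * derivLogLinProd (fun i => (a i)⁻¹) κ z).im := by
  have := im_mul_derivLogLinProd_nonneg h.summable_mul_abs_inv (σ := 1)
    (fun i => by simpa using (h.pos i).le) hz
  simpa using this

lemma im_mul_inv_pos (h : IsFactorFamily a κ) [Nonempty ι] (hz : z.im ≠ 0) :
    0 < z.im * (z * derivLogLinProd (fun i => (a i)⁻¹) κ z).im := by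
  have := im_mul_derivLogLinProd_pos h.summable_mul_abs_inv (σ := 1)
    (fun i => by simpa using h.pos i) h.exponent_pos hz
  simpa using this

lemma im_mul_neg_inv_nonpos (h : IsFactorFamily a κ) (hz : z.im ≠ 0) :
    z.im * (z * derivLogLinProd (fun i => -(a i)⁻¹) κ z).im ≤ 0 := by
  have := im_mul_derivLogLinProd_nonneg h.summable_mul_abs_neg_inv (σ := -1)
    (fun i => by simpa using (h.pos i).le) hz
  linarith

lemma im_mul_neg_inv_neg (h : IsFactorFamily a κ) [Nonempty ι] (hz : z.im ≠ 0) :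
    z.im * (z * derivLogLinProd (fun i => -(a i)⁻¹) κ z).im < 0 := by
  have := im_mul_derivLogLinProd_pos h.summable_mul_abs_neg_inv (σ := -1)
    (fun i => by simpa using h.pos i) h.exponent_pos hz
  linarith

end IsFactorFamily

section GenW

variable {ι₁ ι₂ ι₃ ι₄ : Type*} {A A₀ B : ℝ}
  {a : ι₁ → ℝ} {κ : ι₁ → ℕ} {b : ι₂ → ℝ} {lam : ι₂ → ℕ}
  {c : ι₃ → ℝ} {κ' : ι₃ → ℕ} {d : ι₄ → ℝ} {lam' : ι₄ → ℕ}

/-- The numerator of `genW`, without the factor `z ^ B`. -/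
noncomputable def genWNum (A A₀ : ℝ) (a : ι₁ → ℝ) (κ : ι₁ → ℕ) (c : ι₃ → ℝ) (κ' : ι₃ → ℕ)
    (z : ℂ) : ℂ :=
  Complex.exp (A * z + A₀ / z) * (linProd (fun i => (a i)⁻¹) κ z * linProd (fun i => (c i)⁻¹) κ' z⁻¹)

/-- The denominator of `genW`. -/
noncomputable def genWDen (b : ι₂ → ℝ) (lam : ι₂ → ℕ) (d : ι₄ → ℝ) (lam' : ι₄ → ℕ) (z : ℂ) : ℂ :=
  linProd (fun i => -(b i)⁻¹) lam z * linProd (fun i => -(d i)⁻¹) lam' z⁻¹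

/-- A logarithm of `genW` off the real axis. -/
noncomputable def logGenW (A A₀ B : ℝ)
    (a : ι₁ → ℝ) (κ : ι₁ → ℕ) (b : ι₂ → ℝ) (lam : ι₂ → ℕ)
    (c : ι₃ → ℝ) (κ' : ι₃ → ℕ) (d : ι₄ → ℝ) (lam' : ι₄ → ℕ) (z : ℂ) : ℂ :=
  A * z + A₀ * z⁻¹ + B * Complex.log z
    + (logLinProd (fun i => (a i)⁻¹) κ z - logLinProd (fun i => -(b i)⁻¹) lam z)
    + (logLinProd (fun i => (c i)⁻¹) κ' z⁻¹ - logLinProd (fun i => -(d i)⁻¹) lam' z⁻¹)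

/-- The logarithmic derivative of `genW`. -/
noncomputable def derivLogGenW (A A₀ B : ℝ)
    (a : ι₁ → ℝ) (κ : ι₁ → ℕ) (b : ι₂ → ℝ) (lam : ι₂ → ℕ)
    (c : ι₃ → ℝ) (κ' : ι₃ → ℕ) (d : ι₄ → ℝ) (lam' : ι₄ → ℕ) (z : ℂ) : ℂ :=
  A + A₀ * (-(z ^ 2)⁻¹) + B * z⁻¹
    + (derivLogLinProd (fun i => (a i)⁻¹) κ z - derivLogLinProd (fun i => -(b i)⁻¹) lam z)
    + (derivLogLinProd (fun i => (c i)⁻¹) κ' z⁻¹ * (-(z ^ 2)⁻¹)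
      - derivLogLinProd (fun i => -(d i)⁻¹) lam' z⁻¹ * (-(z ^ 2)⁻¹))

lemma genW_eq (z : ℂ) : genW A A₀ B a κ b lam c κ' d lam' z
    = genWNum A A₀ a κ c κ' z / genWDen b lam d lam' z * z ^ (B : ℂ) := by
  have h₁ : ∀ ν, 1 + z / (a ν : ℂ) = 1 + (((a ν)⁻¹ : ℝ) : ℂ) * z := fun ν => by
    push_cast; ring
  have h₂ : ∀ ν, 1 - z / (b ν : ℂ) = 1 + ((-(b ν)⁻¹ : ℝ) : ℂ) * z := fun ν => by
    push_cast; ring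
  have h₃ : ∀ ν, 1 + 1 / (z * (c ν : ℂ)) = 1 + (((c ν)⁻¹ : ℝ) : ℂ) * z⁻¹ := fun ν => by
    push_cast; rw [one_div, mul_inv]; ring
  have h₄ : ∀ ν, 1 - 1 / (z * (d ν : ℂ)) = 1 + ((-(d ν)⁻¹ : ℝ) : ℂ) * z⁻¹ := fun ν => by
    push_cast; rw [one_div, mul_inv]; ring
  simp only [genW, h₁, h₂, h₃, h₄]
  simp only [genWNum, genWDen, linProd]
  simp only [div_eq_mul_inv, mul_inv]
  ring

lemma inv_im_ne_zero {z : ℂ} (hz : z.im ≠ 0) : (z⁻¹).im ≠ 0 := by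
  rw [Complex.inv_im]
  refine div_ne_zero (neg_ne_zero.2 hz) ?_
  exact (Complex.normSq_pos.2 fun h => hz (by simp [h])).ne'

lemma im_mul_derivLogGenW_pos (hA : 0 ≤ A) (hA₀ : 0 ≤ A₀)
    (ha : IsFactorFamily a κ) (hb : IsFactorFamily b lam)
    (hc : IsFactorFamily c κ') (hd : IsFactorFamily d lam')
    (hne : 0 < A ∨ 0 < A₀ ∨ Nonempty ι₁ ∨ Nonempty ι₂ ∨ Nonempty ι₃ ∨ Nonempty ι₄)
    {z : ℂ} (hz : z.im ≠ 0) :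
    0 < z.im * (z * derivLogGenW A A₀ B a κ b lam c κ' d lam' z).im := by
  have hz0 : z ≠ 0 := fun h => hz (by simp [h])
  have hw := inv_im_ne_zero hz
  have hn : 0 < Complex.normSq z := Complex.normSq_pos.2 hz0
  have e : z * derivLogGenW A A₀ B a κ b lam c κ' d lam' z
      = A * z - A₀ * z⁻¹ + B
        + z * derivLogLinProd (fun i => (a i)⁻¹) κ z
        - z * derivLogLinProd (fun i => -(b i)⁻¹) lam z
        - z⁻¹ * derivLogLinProd (fun i => (c i)⁻¹) κ' z⁻¹
        + z⁻¹ * derivLogLinProd (fun i => -(d i)⁻¹) lam' z⁻¹ := by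
    unfold derivLogGenW
    field_simp
    ring
  have hi : (z⁻¹).im = -(z.im / Complex.normSq z) := by rw [Complex.inv_im, neg_div]
  -- Expresses the sign condition at `z` through the one at `z⁻¹`, so the factor lemmas apply there.
  have hswap : ∀ t : ℝ, z.im * t = -(Complex.normSq z * ((z⁻¹).im * t)) := fun t => by
    rw [hi]; field_simp
  have p₁ := ha.im_mul_inv_nonneg hz
  have p₂ := hb.im_mul_neg_inv_nonpos hz
  have p₃ := mul_nonneg hn.le (hc.im_mul_inv_nonneg hw)
  have p₄ := mul_nonneg hn.le (neg_nonneg.2 (hd.im_mul_neg_inv_nonpos hw))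
  have p₅ : 0 ≤ z.im ^ 2 * A := by positivity
  have p₆ : 0 ≤ z.im ^ 2 * (A₀ / Complex.normSq z) := by positivity
  rw [e]
  simp only [Complex.add_im, Complex.sub_im, Complex.im_ofReal_mul, Complex.ofReal_im, add_zero,
    mul_add, mul_sub]
  rw [hswap (z⁻¹ * derivLogLinProd (fun i => (c i)⁻¹) κ' z⁻¹).im,
    hswap (z⁻¹ * derivLogLinProd (fun i => -(d i)⁻¹) lam' z⁻¹).im]
  have q₅ : z.im * (A * z.im) = z.im ^ 2 * A := by ring
  have q₆ : z.im * (A₀ * (z⁻¹).im) = -(z.im ^ 2 * (A₀ / Complex.normSq z)) := by rw [hi]; ring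
  rw [q₅, q₆]
  rcases hne with h | h | h | h | h | h
  · have : 0 < z.im ^ 2 * A := by positivity
    linarith
  · have : 0 < z.im ^ 2 * (A₀ / Complex.normSq z) := by positivity
    linarith
  · have := ha.im_mul_inv_pos hz
    linarith
  · have := hb.im_mul_neg_inv_neg hz
    linarith
  · have := mul_pos hn (hc.im_mul_inv_pos hw)
    linarith
  · have := mul_pos hn (neg_pos.2 (hd.im_mul_neg_inv_neg hw))
    linarith

lemma hasDerivAt_logGenW
    (ha : IsFactorFamily a κ) (hb : IsFactorFamily b lam)
    (hc : IsFactorFamily c κ') (hd : IsFactorFamily d lam') {z : ℂ} (hz : z.im ≠ 0) :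
    HasDerivAt (logGenW A A₀ B a κ b lam c κ' d lam')
      (derivLogGenW A A₀ B a κ b lam c κ' d lam' z) z := by
  have hz0 : z ≠ 0 := fun h => hz (by simp [h])
  have hw := inv_im_ne_zero hz
  have hinv := hasDerivAt_inv hz0
  have h₁ : HasDerivAt (fun z : ℂ => (A : ℂ) * z) A z := by
    simpa using (hasDerivAt_id z).const_mul (A : ℂ)
  exact (((h₁.add (hinv.const_mul _)).add ((Complex.hasDerivAt_log (Or.inr hz)).const_mul _)).add
    ((hasDerivAt_logLinProd ha.summable_mul_abs_inv hz).sub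
      (hasDerivAt_logLinProd hb.summable_mul_abs_neg_inv hz))).add
    (((hasDerivAt_logLinProd hc.summable_mul_abs_inv hw).comp z hinv).sub
      ((hasDerivAt_logLinProd hd.summable_mul_abs_neg_inv hw).comp z hinv))

lemma exp_logGenW
    (ha : IsFactorFamily a κ) (hb : IsFactorFamily b lam)
    (hc : IsFactorFamily c κ') (hd : IsFactorFamily d lam') {z : ℂ} (hz : z.im ≠ 0) :
    Complex.exp (logGenW A A₀ B a κ b lam c κ' d lam' z)
      = genW A A₀ B a κ b lam c κ' d lam' z := by
  have hz0 : z ≠ 0 := fun h => hz (by simp [h])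
  have hw := inv_im_ne_zero hz
  rw [genW_eq, genWNum, genWDen, logGenW, Complex.exp_add, Complex.exp_add, Complex.exp_add,
    Complex.exp_sub, Complex.exp_sub,
    exp_logLinProd ha.summable_mul_abs_inv fun i => one_add_ofReal_mul_ne_zero _ hz,
    exp_logLinProd hb.summable_mul_abs_neg_inv fun i => one_add_ofReal_mul_ne_zero _ hz,
    exp_logLinProd hc.summable_mul_abs_inv fun i => one_add_ofReal_mul_ne_zero _ hw,
    exp_logLinProd hd.summable_mul_abs_neg_inv fun i => one_add_ofReal_mul_ne_zero _ hw,
    Complex.cpow_def_of_ne_zero hz0, mul_comm (Complex.log z), div_eq_mul_inv (A₀ : ℂ)]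
  simp only [div_eq_mul_inv, mul_inv]
  ring

theorem isIncreasingQuotient_genW (hA : 0 ≤ A) (hA₀ : 0 ≤ A₀)
    (ha : IsFactorFamily a κ) (hb : IsFactorFamily b lam)
    (hc : IsFactorFamily c κ') (hd : IsFactorFamily d lam')
    (hne : 0 < A ∨ 0 < A₀ ∨ Nonempty ι₁ ∨ Nonempty ι₂ ∨ Nonempty ι₃ ∨ Nonempty ι₄) :
    IsIncreasingQuotient (genW A A₀ B a κ b lam c κ' d lam') (genWNum A A₀ a κ c κ')
      (genWDen b lam d lam') (logGenW A A₀ B a κ b lam c κ' d lam')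
      (derivLogGenW A A₀ B a κ b lam c κ' d lam') B where
  eq_div := genW_eq
  continuousAt_num z hz := by
    have h₁ := (continuous_linProd ha.summable_mul_abs_inv).continuousAt (x := z)
    have h₂ := (continuous_linProd hc.summable_mul_abs_inv).continuousAt.comp (continuousAt_inv₀ hz)
    have h₃ : ContinuousAt (fun z : ℂ => Complex.exp (A * z + A₀ / z)) z := by
      fun_prop (disch := assumption)
    exact h₃.mul (h₁.mul h₂)
  continuousAt_den z hz := by
    have h₁ := (continuous_linProd hb.summable_mul_abs_neg_inv).continuousAt (x := z)
    have h₂ := (continuous_linProd hd.summable_mul_abs_neg_inv).continuousAt.comp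
      (continuousAt_inv₀ hz)
    exact h₁.mul h₂
  num_conj z := by
    simp only [genWNum, map_mul, ← Complex.exp_conj, map_add, map_div₀, Complex.conj_ofReal,
      linProd_conj, ← map_inv₀]
  den_conj z := by
    simp only [genWDen, map_mul, linProd_conj, ← map_inv₀]
  num_ne_zero x hx := by
    refine mul_ne_zero (Complex.exp_ne_zero _) (mul_ne_zero ?_ ?_)
    · exact linProd_ne_zero ha.summable_mul_abs_inv fun i => one_add_inv_mul_ne_zero (ha.pos i) hx
    · refine linProd_ne_zero hc.summable_mul_abs_inv fun i => ?_
      rw [← Complex.ofReal_inv]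
      exact one_add_inv_mul_ne_zero (hc.pos i) (inv_pos.2 hx)
  den_ne_zero x hx := by
    refine mul_ne_zero ?_ ?_
    · refine linProd_ne_zero hb.summable_mul_abs_neg_inv fun i => ?_
      rw [Complex.ofReal_neg, neg_mul_neg]
      exact one_add_inv_mul_ne_zero (hb.pos i) hx
    · refine linProd_ne_zero hd.summable_mul_abs_neg_inv fun i => ?_
      rw [Complex.ofReal_neg, inv_neg, neg_mul_neg, ← Complex.ofReal_inv]
      exact one_add_inv_mul_ne_zero (hd.pos i) (inv_pos.2 hx)
  exp_eq z hz := exp_logGenW ha hb hc hd hz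
  hasDerivAt z hz := hasDerivAt_logGenW ha hb hc hd hz
  im_pos z hz := im_mul_derivLogGenW_pos hA hA₀ ha hb hc hd hne hz

end GenW

theorem mainTheorem5 {ι₁ ι₂ ι₃ ι₄ : Type*} (A A₀ B : ℝ) (hA : 0 ≤ A) (hA₀ : 0 ≤ A₀)
    (a : ι₁ → ℝ) (κ : ι₁ → ℕ) (b : ι₂ → ℝ) (lam : ι₂ → ℕ)
    (c : ι₃ → ℝ) (κ' : ι₃ → ℕ) (d : ι₄ → ℝ) (lam' : ι₄ → ℕ)
    (ha : IsFactorFamily a κ) (hb : IsFactorFamily b lam)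
    (hc : IsFactorFamily c κ') (hd : IsFactorFamily d lam')
    (W : ℂ → ℂ) (hW : W = genW A A₀ B a κ b lam c κ' d lam')
    (hnontrivial : ∃ z ∈ Complex.slitPlane, W z ≠ z ^ (B : ℂ))
    (α : ℂ) (hα : α.im ≠ 0)
    (hα_pos : (α * Complex.exp (Complex.I * B * Real.pi)).im ≠ 0)
    (hα_neg : (α * Complex.exp (-(Complex.I * B * Real.pi))).im ≠ 0) :
    -- the `α`-points are non-real and simple
    (∀ z ∈ alphaSet W α, z.im ≠ 0 ∧ AnalyticAt ℂ W z ∧ deriv W z ≠ 0) ∧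
    -- they are distinct in modulus
    (∀ z ∈ alphaSet W α, ∀ w ∈ alphaSet W α, ‖z‖ = ‖w‖ → z = w) ∧
    -- they can be numbered in the order of their moduli
    (∀ r R : ℝ, 0 < r → {z ∈ alphaSet W α | r ≤ ‖z‖ ∧ ‖z‖ ≤ R}.Finite) ∧
    -- consecutive ones lie in opposite half-planes
    (∀ z w : ℂ, ConsecutiveByNorm (alphaSet W α) z w → z.im * w.im < 0) ∧
    -- there are none on the positive axis
    (∀ x : ℝ, 0 < x → W x ≠ α) ∧
    -- both boundary values on the negative axis exist and differ from `α`
    (∀ x : ℝ, 0 < x →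
      (∃ v : ℂ, Tendsto (fun y : ℝ => W (-(x : ℂ) + y * Complex.I)) (𝓝[>] 0) (𝓝 v) ∧ v ≠ α) ∧
      (∃ v : ℂ, Tendsto (fun y : ℝ => W (-(x : ℂ) + y * Complex.I)) (𝓝[<] 0) (𝓝 v) ∧ v ≠ α)) := by
  -- Without any of these ingredients `W` would be exactly `z ^ B`; one of them makes the imaginary
  -- part strictly signed.
  have hne : 0 < A ∨ 0 < A₀ ∨ Nonempty ι₁ ∨ Nonempty ι₂ ∨ Nonempty ι₃ ∨ Nonempty ι₄ := by
    by_contra hcon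
    simp only [not_or, not_lt, not_nonempty_iff] at hcon
    obtain ⟨h₁, h₂, _, _, _, _⟩ := hcon
    obtain ⟨z, -, hz⟩ := hnontrivial
    apply hz
    rw [hW, le_antisymm h₁ hA, le_antisymm h₂ hA₀]
    simp [genW]
  have h := isIncreasingQuotient_genW (B := B) hA hA₀ ha hb hc hd hne
  rw [← hW] at h
  have hiff := fun z : ℂ => h.mem_alphaSet_iff hα hα_neg (z := z)
  refine ⟨fun z hz => ?_, fun z hz w hw hn => ?_, fun r R hr => ?_, fun z w hzw => ?_,
    fun x hx => ?_, fun x hx => ⟨⟨_, h.tendsto_neg_ofReal_add_mul_I hx, ?_⟩,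
      ⟨_, h.tendsto_neg_ofReal_add_mul_I_lt hx, ?_⟩⟩⟩
  · have him := ((hiff z).1 hz).1
    exact ⟨him, h.analyticAt him, (h.hasDerivAt_mul him).deriv ▸ h.mul_deriv_ne_zero him⟩
  · have hz' := (hiff z).1 hz
    have hw' := (hiff w).1 hw
    exact h.eq_of_mem_of_norm_eq hα hz'.1 hw'.1 hz'.2 hw'.2 hn
  · exact h.finite_setOf_norm_mem hα hα_pos hα_neg hr
  · exact h.im_mul_im_neg_of_consecutive hα hα_pos hα_neg hzw
  · exact h.ne_of_im_eq_zero hα hα_neg (Complex.ofReal_ne_zero.2 hx.ne') (Complex.ofReal_im x)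
  · rintro rfl
    exact hα_neg (h.im_neg_ofReal_mul_exp hx)
  -- The value from below is the conjugate of the value from above, so the condition on `α * exp
  -- (iπB)` is the relevant one.
  · intro e
    apply hα_pos
    have := h.im_neg_ofReal_mul_exp hx
    rw [← Complex.conj_conj (W (-x)), e, IsIncreasingQuotient.im_conj_mul_exp_neg] at this
    exact neg_eq_zero.1 this
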